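/- Let $m>0$ and let $U\subset\mathbb R^4$ be an open set (a coordinate domain) with coordinates $(x^0,x^1,x^2,x^3)$. Let $g$ be a Lorentzian metric on $U$ of signature $(+,-,-,-)$, $A$ a real covector field, $\xi^a$ ($a=1,2$) a complex spinor field, and $\sigma_{\alpha a\dot b}$ Pauli matrices for $g$, i.e. Hermitian $2\times2$ matrices with $\sigma_{\alpha a\dot b}\sigma_\beta{}^{c\dot b}+\sigma_{\beta a\dot b}\sigma_\alpha{}^{c\dot b}=2g_{\alpha\beta}\delta_a{}^c$, where $\sigma_\alpha{}^{a\dot b}=\epsilon^{ac}\epsilon^{\dot b\dot d}\sigma_{\alpha c\dot d}$ and $\epsilon=\begin{pmatrix}0&1\\-1&0\end{pmatrix}$; $g$, $\sigma$, $\xi$ are differentiable. Suppose that $g,A,\sigma,\xi$ do not depend on $x^3$, that $g_{33}=-1$ and $g_{\alpha3}=g_{3\alpha}=0$ for $\alpha\ne3$, that $A_3=0$, that $\sigma_{3a\dot b}=\mathrm{diag}(1,-1)$, and that $|\xi^1|^2-|\xi^2|^2>0$. *The coframe and the density.* Put $\eta_{\dot b}=\xi^a\sigma_{3a\dot b}$,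 $\eta^{\dot a}=\epsilon^{\dot a\dot b}\eta_{\dot b}$, $s=\xi^a\bar\eta_a$ $(=|\xi^1|^2-|\xi^2|^2)$, and let the real covector fields $\vartheta^0,\dots,\vartheta^3$ and the density $\rho$ be given by $$\rho=|s|\sqrt{|\det g|},\quad(\vartheta^0+\vartheta^3)_\alpha=|s|^{-1}\xi^a\sigma_{\alpha a\dot b}\bar\xi^{\dot b},\quad(\vartheta^0-\vartheta^3)_\alpha=|s|^{-1}\bar\eta^a\sigma_{\alpha a\dot b}\eta^{\dot b},\quad(\vartheta^1+i\vartheta^2)_\alpha=-|s|^{-1}\xi^a\sigma_{\alpha a\dot b}\eta^{\dot b}.$$ *The Lagrangian density $L(\vartheta,\rho)$.* On $U\times\mathbb R$, with extra coordinate $x^4$, let $\boldsymbol\vartheta^0=(\vartheta^0,0)$, $\boldsymbol\vartheta^3=(\vartheta^3,0)$, $\boldsymbol\vartheta^1+i\boldsymbol\vartheta^2=(\vartheta^1+i\vartheta^2,0)\,e^{-2imx^4}$, $\boldsymbol\vartheta^4=(0,0,0,0,1)$, and $$\mathbf g=\begin{pmatrix}g_{\alpha\beta}-\frac1{m^2}A_\alpha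 A_\beta&\frac1mA_\alpha\\ \frac1mA_\beta&-1\end{pmatrix},\qquad\mathbf T^{\mathrm{ax}}=\tfrac13\bigl(\boldsymbol\vartheta^0\wedge d\boldsymbol\vartheta^0-\boldsymbol\vartheta^1\wedge d\boldsymbol\vartheta^1-\boldsymbol\vartheta^2\wedge d\boldsymbol\vartheta^2-\boldsymbol\vartheta^3\wedge d\boldsymbol\vartheta^3-\boldsymbol\vartheta^4\wedge d\boldsymbol\vartheta^4\bigr).$$ Put $L(\vartheta,\rho)=\|\mathbf T^{\mathrm{ax}}\|^2\rho$, where $\|\mathbf T^{\mathrm{ax}}\|^2=\frac1{3!}\mathbf T^{\mathrm{ax}}_{\boldsymbol{\alpha\beta\gamma}}\mathbf T^{\mathrm{ax}}_{\boldsymbol{\kappa\lambda\mu}}\mathbf g^{\boldsymbol{\alpha\kappa}}\mathbf g^{\boldsymbol{\beta\lambda}}\mathbf g^{\boldsymbol{\gamma\mu}}$. *The Dirac Lagrangian densities.* Put $$L^\pm_{\mathrm{Dir}}(\xi)=\Bigl[\tfrac i2\bigl(\bar\xi^{\dot b}\sigma^\alpha{}_{a\dot b}\nabla_\alpha\xi^a-\xi^a\sigma^\alpha{}_{a\dot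 b}\nabla_\alpha\bar\xi^{\dot b}\bigr)+A_\alpha\xi^a\sigma^\alpha{}_{a\dot b}\bar\xi^{\dot b}\mp m\,\xi^a\sigma_{3a\dot b}\bar\xi^{\dot b}\Bigr]\sqrt{|\det g|},$$ where $\sigma^\alpha{}_{a\dot b}=g^{\alpha\beta}\sigma_{\beta a\dot b}$, $\nabla_\alpha\xi^a=\partial_\alpha\xi^a+\frac14\sigma_\beta{}^{a\dot c}(\partial_\alpha\sigma^\beta{}_{b\dot c}+\Gamma^\beta{}_{\alpha\gamma}\sigma^\gamma{}_{b\dot c})\xi^b$, $\nabla_\alpha\bar\xi^{\dot a}$ is its complex conjugate, and $\Gamma^\beta{}_{\alpha\gamma}$ are the Christoffel symbols of $g$. Then, at every point of $U\times\mathbb R$, $L^+_{\mathrm{Dir}}(\xi)\ne L^-_{\mathrm{Dir}}(\xi)$ and $$L(\vartheta,\rho)=-\frac{32m}{9}\,\frac{L^+_{\mathrm{Dir}}(\xi)\,L^-_{\mathrm{Dir}}(\xi)}{L^+_{\mathrm{Dir}}(\xi)-L^-_{\mathrm{Dir}}(\xi)}.$$ -/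

import Mathlib

namespace CosseratDirac

noncomputable section

/-! ### Calculus in local coordinates

Everything is local, so spacetime is an open set of points `x = (x⁰, x¹, x², x³)`, and tensor fields
are given by their components. Differential forms are identified with covariant antisymmetric
tensors. -/

/-- Points of the coordinate domain of the `(1+3)`-dimensional spacetime. -/
abbrev Point : Type := Fin 4 → ℝ

/-- Extended tensor indices: `Sum.inl α` is the index `α = 0, 1, 2, 3`, and `Sum.inr ()` is the
index `4`. -/
abbrev ExtIndex : Type := Fin 4 ⊕ Unit

/-- Points `(x⁰, x¹, x², x³, x⁴)` of the Kaluza-Klein extension. -/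
abbrev ExtPoint : Type := ExtIndex → ℝ

/-- The point `(x⁰, x¹, x², x³)` below an extended point. -/
def base (X : ExtPoint) : Point := fun α => X (Sum.inl α)

/-- The partial derivative `∂_i f` at `x`. -/
def partialDeriv {ι : Type} [Fintype ι] [DecidableEq ι] {F : Type} [NormedAddCommGroup F]
    [NormedSpace ℝ F] (i : ι) (f : (ι → ℝ) → F) (x : ι → ℝ) : F :=
  fderiv ℝ f x (Pi.single i 1)

/-- The exterior derivative of a covector field: `(dω)_{ij} = ∂_i ω_j - ∂_j ω_i`. -/
def extDerivCovector {ι : Type} [Fintype ι] [DecidableEq ι] (ω : (ι → ℝ) → ι → ℝ)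
    (x : ι → ℝ) (i j : ι) : ℝ :=
  partialDeriv i (fun y => ω y j) x - partialDeriv j (fun y => ω y i) x

/-- The wedge product of a covector and a 2-form:
`(u ∧ F)_{ijk} = u_i F_{jk} + u_j F_{ki} + u_k F_{ij}`. -/
def wedge {ι : Type} (u : ι → ℝ) (F : ι → ι → ℝ) (i j k : ι) : ℝ :=
  u i * F j k + u j * F k i + u k * F i j

/-- The square `‖T‖² = (1/3!) T_{ijk} T_{lpq} G^{il} G^{jp} G^{kq}` of a 3-form with respect to the
metric with covariant components `G`. -/
def normSqThreeForm {ι : Type} [Fintype ι] [DecidableEq ι] (G : Matrix ι ι ℝ)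
    (T : ι → ι → ι → ℝ) : ℝ :=
  (1 / 6) * ∑ i, ∑ j, ∑ k, ∑ l, ∑ p, ∑ q,
    T i j k * T l p q * G⁻¹ i l * G⁻¹ j p * G⁻¹ k q

/-- A function on `U` does not depend on the coordinate `x³`. -/
def IndepOfX3 {F : Type} (U : Set Point) (f : Point → F) : Prop :=
  ∀ x ∈ U, ∀ y ∈ U, (∀ α, α ≠ 3 → x α = y α) → f x = f y

/-! ### The metric -/

/-- The Minkowski matrix `diag(1, -1, -1, -1)`. -/
def minkowski : Matrix (Fin 4) (Fin 4) ℝ := Matrix.diagonal ![1, -1, -1, -1]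

/-- `g` is a (differentiable) Lorentzian metric on `U`: at each point it is a symmetric matrix that
is congruent to `diag(1, -1, -1, -1)`. -/
structure IsLorentzMetric (U : Set Point) (g : Point → Matrix (Fin 4) (Fin 4) ℝ) : Prop where
  differentiable : ∀ α β, DifferentiableOn ℝ (fun x => g x α β) U
  signature : ∀ x ∈ U, ∃ P : Matrix (Fin 4) (Fin 4) ℝ,
    IsUnit P.det ∧ g x = P.transpose * minkowski * P

/-- The Christoffel symbols
`Γ^β_{αγ} = ½ g^{βδ} (∂_α g_{γδ} + ∂_γ g_{αδ} - ∂_δ g_{αγ})`. -/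
def christoffel (g : Point → Matrix (Fin 4) (Fin 4) ℝ) (x : Point) (β α γ : Fin 4) : ℝ :=
  (1 / 2) * ∑ δ, (g x)⁻¹ β δ *
    (partialDeriv α (fun y => g y γ δ) x + partialDeriv γ (fun y => g y α δ) x
      - partialDeriv δ (fun y => g y α γ) x)

/-! ### Pauli matrices and spinors

Spinor indices `1, 2` are the elements `0, 1` of `Fin 2`. -/

/-- The metric spinor `ε_{ab} = ε^{ab}`, also with dotted indices. -/
def eps : Matrix (Fin 2) (Fin 2) ℂ := !![0, 1; -1, 0]

/-- `σ_α{}^{aḃ} = ε^{ac} ε^{ḃḋ} σ_{αcḋ}` for a family `S α a b = σ_{αaḃ}`. -/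
def raiseSpinor (S : Fin 4 → Matrix (Fin 2) (Fin 2) ℂ) (α : Fin 4) (a b : Fin 2) : ℂ :=
  ∑ c, ∑ d, eps a c * eps b d * S α c d

/-- `σ^α{}_{aḃ} = g^{αβ} σ_{βaḃ}`. -/
def raiseTensor (g : Point → Matrix (Fin 4) (Fin 4) ℝ)
    (σ : Point → Fin 4 → Matrix (Fin 2) (Fin 2) ℂ) (x : Point) (α : Fin 4) (a b : Fin 2) : ℂ :=
  ∑ β, ((g x)⁻¹ α β : ℂ) * σ x β a b

/-- `σ` is a (differentiable) field of Pauli matrices for the metric `g` on `U`: Hermitian matrices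
`σ_{αaḃ}` with `σ_{αaḃ} σ_β{}^{cḃ} + σ_{βaḃ} σ_α{}^{cḃ} = 2 g_{αβ} δ_a{}^c`. -/
structure IsPauli (U : Set Point) (g : Point → Matrix (Fin 4) (Fin 4) ℝ)
    (σ : Point → Fin 4 → Matrix (Fin 2) (Fin 2) ℂ) : Prop where
  differentiable : ∀ α a b, DifferentiableOn ℝ (fun x => σ x α a b) U
  hermitian : ∀ x ∈ U, ∀ α, (σ x α).IsHermitian
  clifford : ∀ x ∈ U, ∀ α β : Fin 4, ∀ a c : Fin 2,
    ∑ b, (σ x α a b * raiseSpinor (σ x) β c b + σ x β a b * raiseSpinor (σ x) α c b)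
      = if a = c then 2 * (g x α β : ℂ) else 0

/-- The covariant derivative of a spinor field,
`∇_α ξ^a = ∂_α ξ^a + ¼ σ_β{}^{aċ} (∂_α σ^β{}_{bċ} + Γ^β_{αγ} σ^γ{}_{bċ}) ξ^b`.
That of the conjugate field is the conjugate `∇_α ξ̄^{ḃ} = conj (∇_α ξ^b)`. -/
def covDerivSpinor (g : Point → Matrix (Fin 4) (Fin 4) ℝ)
    (σ : Point → Fin 4 → Matrix (Fin 2) (Fin 2) ℂ) (ξ : Point → Fin 2 → ℂ)
    (x : Point) (α : Fin 4) (a : Fin 2) : ℂ :=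
  partialDeriv α (fun y => ξ y a) x
    + (1 / 4) * ∑ β, ∑ b, ∑ c, raiseSpinor (σ x) β a c *
        (partialDeriv α (fun y => raiseTensor g σ y β b c) x
          + ∑ γ, (christoffel g x β α γ : ℂ) * raiseTensor g σ x γ b c) * ξ x b

/-! ### The Dirac Lagrangian densities -/

/-- The density with mass term `-μ ξ^a σ_{3aḃ} ξ̄^{ḃ}`:
`[ (i/2)(ξ̄^ḃ σ^α_{aḃ} ∇_α ξ^a - ξ^a σ^α_{aḃ} ∇_α ξ̄^ḃ) + A_α ξ^a σ^α_{aḃ} ξ̄^ḃ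
  - μ ξ^a σ_{3aḃ} ξ̄^ḃ ] √|det g|`. -/
def diracLagrangian (μ : ℝ) (g : Point → Matrix (Fin 4) (Fin 4) ℝ) (A : Point → Fin 4 → ℝ)
    (σ : Point → Fin 4 → Matrix (Fin 2) (Fin 2) ℂ) (ξ : Point → Fin 2 → ℂ) (x : Point) : ℂ :=
  (Complex.I / 2 * ∑ α, ∑ a, ∑ b,
      (star (ξ x b) * raiseTensor g σ x α a b * covDerivSpinor g σ ξ x α a
        - ξ x a * raiseTensor g σ x α a b * star (covDerivSpinor g σ ξ x α b))
    + ∑ α, ∑ a, ∑ b, (A x α : ℂ) * (ξ x a * raiseTensor g σ x α a b * star (ξ x b))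
    - (μ : ℂ) * ∑ a, ∑ b, ξ x a * σ x 3 a b * star (ξ x b))
  * (Real.sqrt |(g x).det| : ℂ)

/-- `L_Dir⁺(ξ)`. -/
def diracPlus (m : ℝ) (g : Point → Matrix (Fin 4) (Fin 4) ℝ) (A : Point → Fin 4 → ℝ)
    (σ : Point → Fin 4 → Matrix (Fin 2) (Fin 2) ℂ) (ξ : Point → Fin 2 → ℂ) (x : Point) : ℂ :=
  diracLagrangian m g A σ ξ x

/-- `L_Dir⁻(ξ)`. -/
def diracMinus (m : ℝ) (g : Point → Matrix (Fin 4) (Fin 4) ℝ) (A : Point → Fin 4 → ℝ)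
    (σ : Point → Fin 4 → Matrix (Fin 2) (Fin 2) ℂ) (ξ : Point → Fin 2 → ℂ) (x : Point) : ℂ :=
  diracLagrangian (-m) g A σ ξ x

/-! ### The Lagrangian density of a coframe and a density

A quartet of covector fields is `ϑ : Fin 4 → Point → Fin 4 → ℝ`, with `ϑ j x α = ϑ^j_α (x)`. -/

/-- The extension of a covector field by a zero last component. -/
def extendCovector (ω : Point → Fin 4 → ℝ) (X : ExtPoint) : ExtIndex → ℝ :=
  Sum.elim (ω (base X)) (fun _ => 0)

/-- The complex covector field `(ϑ¹ + iϑ²) e^{-2imx⁴}`, extended by a zero last component. -/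
def extendRotating (m : ℝ) (ϑ : Fin 4 → Point → Fin 4 → ℝ) (X : ExtPoint) : ExtIndex → ℂ :=
  Sum.elim
    (fun α => ((ϑ 1 (base X) α : ℂ) + Complex.I * (ϑ 2 (base X) α : ℂ))
      * Complex.exp (-2 * Complex.I * (m : ℂ) * (X (Sum.inr ()) : ℂ)))
    (fun _ => 0)

/-- The extended coframe `𝛝⁰, 𝛝¹, 𝛝², 𝛝³, 𝛝⁴`. -/
def extCoframe (m : ℝ) (ϑ : Fin 4 → Point → Fin 4 → ℝ) : Fin 5 → ExtPoint → ExtIndex → ℝ :=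
  ![extendCovector (ϑ 0),
    fun X i => (extendRotating m ϑ X i).re,
    fun X i => (extendRotating m ϑ X i).im,
    extendCovector (ϑ 3),
    fun _ => Sum.elim (fun _ => 0) (fun _ => 1)]

/-- The extended metric
`𝐠 = [[g_{αβ} - (1/m²) A_α A_β, (1/m) A_α], [(1/m) A_β, -1]]`. -/
def extMetric (m : ℝ) (g : Point → Matrix (Fin 4) (Fin 4) ℝ) (A : Point → Fin 4 → ℝ)
    (X : ExtPoint) : Matrix ExtIndex ExtIndex ℝ :=
  Matrix.fromBlocks
    (Matrix.of fun α β => g (base X) α β - (1 / m ^ 2) * A (base X) α * A (base X) β)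
    (Matrix.of fun α _ => (1 / m) * A (base X) α)
    (Matrix.of fun _ β => (1 / m) * A (base X) β)
    (Matrix.of fun _ _ => -1)

/-- The axial torsion
`𝐓 = ⅓ (𝛝⁰∧d𝛝⁰ - 𝛝¹∧d𝛝¹ - 𝛝²∧d𝛝² - 𝛝³∧d𝛝³ - 𝛝⁴∧d𝛝⁴)`. -/
def axialTorsion (m : ℝ) (ϑ : Fin 4 → Point → Fin 4 → ℝ) (X : ExtPoint) (i j k : ExtIndex) : ℝ :=
  (1 / 3) * ∑ n : Fin 5, (![1, -1, -1, -1, -1] : Fin 5 → ℝ) n *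
    wedge (extCoframe m ϑ n X) (extDerivCovector (extCoframe m ϑ n) X) i j k

/-- The Lagrangian density `L(ϑ, ρ) = ‖𝐓‖² ρ`. A priori it is a function of `(x⁰, …, x⁴)`. -/
def lagrangian (m : ℝ) (g : Point → Matrix (Fin 4) (Fin 4) ℝ) (A : Point → Fin 4 → ℝ)
    (ϑ : Fin 4 → Point → Fin 4 → ℝ) (ρ : Point → ℝ) (X : ExtPoint) : ℝ :=
  normSqThreeForm (extMetric m g A X) (axialTorsion m ϑ X) * ρ (base X)

/-! ### The coframe and the density of a bispinor -/

/-- The scalar `s = ξ^a η̄_a` of a bispinor `ξ^a, η_ḃ` at a point. -/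
def bispinorScalar (ξ η : Fin 2 → ℂ) : ℂ := ∑ a, ξ a * star (η a)

/-- `η^{ȧ} = ε^{ȧḃ} η_{ḃ}`. -/
def raiseEta (η : Fin 2 → ℂ) (a : Fin 2) : ℂ := ∑ b, eps a b * η b

/-- The quartet `ϑ` and the density `ρ` are expressed through the bispinor `ξ^a, η_ḃ` on `U`:
`ρ = |s| √|det g|`, `(ϑ⁰ + ϑ³)_α = |s|⁻¹ ξ^a σ_{αaḃ} ξ̄^ḃ`,
`(ϑ⁰ - ϑ³)_α = |s|⁻¹ η̄^a σ_{αaḃ} η^ḃ` and `(ϑ¹ + iϑ²)_α = -|s|⁻¹ ξ^a σ_{αaḃ} η^ḃ`.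
For `s ≠ 0` these equations have exactly one solution, and it satisfies the coframe constraint
`g = ϑ⁰⊗ϑ⁰ - ϑ¹⊗ϑ¹ - ϑ²⊗ϑ² - ϑ³⊗ϑ³`. -/
structure IsExpressedBy (U : Set Point) (g : Point → Matrix (Fin 4) (Fin 4) ℝ)
    (σ : Point → Fin 4 → Matrix (Fin 2) (Fin 2) ℂ) (ξ η : Point → Fin 2 → ℂ)
    (ϑ : Fin 4 → Point → Fin 4 → ℝ) (ρ : Point → ℝ) : Prop where
  density : ∀ x ∈ U, ρ x = ‖bispinorScalar (ξ x) (η x)‖ * Real.sqrt |(g x).det|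
  plus : ∀ x ∈ U, ∀ α, ((ϑ 0 x α + ϑ 3 x α : ℝ) : ℂ)
    = (‖bispinorScalar (ξ x) (η x)‖ : ℂ)⁻¹ * ∑ a, ∑ b, ξ x a * σ x α a b * star (ξ x b)
  minus : ∀ x ∈ U, ∀ α, ((ϑ 0 x α - ϑ 3 x α : ℝ) : ℂ)
    = (‖bispinorScalar (ξ x) (η x)‖ : ℂ)⁻¹ *
      ∑ a, ∑ b, star (raiseEta (η x) a) * σ x α a b * raiseEta (η x) b
  rotating : ∀ x ∈ U, ∀ α, (ϑ 1 x α : ℂ) + Complex.I * (ϑ 2 x α : ℂ)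
    = -(‖bispinorScalar (ξ x) (η x)‖ : ℂ)⁻¹ *
      ∑ a, ∑ b, ξ x a * σ x α a b * raiseEta (η x) b

/-! ### The special case with no dependence on `x³` -/

/-- The covector `η_ḃ = ξ^a σ_{3aḃ}`. -/
def etaOfXi (σ : Point → Fin 4 → Matrix (Fin 2) (Fin 2) ℂ) (ξ : Point → Fin 2 → ℂ)
    (x : Point) (b : Fin 2) : ℂ :=
  ∑ a, ξ x a * σ x 3 a b

/-- The assumptions of the special case: `g`, `A`, `σ`, `ξ` do not depend on `x³`, the metric has
block structure with `g_{33} = -1`, `A_3 = 0`, `σ_3 = diag(1, -1)`, and `|ξ¹|² - |ξ²|² > 0`. -/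
structure IsSpecialCase (U : Set Point) (g : Point → Matrix (Fin 4) (Fin 4) ℝ)
    (A : Point → Fin 4 → ℝ) (σ : Point → Fin 4 → Matrix (Fin 2) (Fin 2) ℂ)
    (ξ : Point → Fin 2 → ℂ) : Prop where
  metric_indep : IndepOfX3 U g
  metric_block : ∀ x ∈ U, ∀ α, α ≠ 3 → g x α 3 = 0 ∧ g x 3 α = 0
  metric_three : ∀ x ∈ U, g x 3 3 = -1
  potential_indep : IndepOfX3 U A
  potential_three : ∀ x ∈ U, A x 3 = 0
  pauli_indep : IndepOfX3 U σ
  pauli_three : ∀ x ∈ U, σ x 3 = !![1, 0; 0, -1]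
  spinor_indep : IndepOfX3 U ξ
  spinor_pos : ∀ x ∈ U, 0 < ‖ξ x 0‖ ^ 2 - ‖ξ x 1‖ ^ 2

end

end CosseratDirac

namespace CosseratDirac

noncomputable section

open Filter Topology

/-! ### Partial derivatives -/

section PartialDeriv

variable {ι : Type} [Fintype ι] [DecidableEq ι]

/-! Expanding `σ_α` in the constant Pauli matrices produces real coefficients `P^k_α`, and the
Clifford relation says exactly that `P` is an orthonormal coframe for `g` (`metric_eq_frame`). In
this frame all spinor algebra has constant coefficients. The hypotheses on `x³` split off the
direction `∂_3`, so only a problem in 1+2 dimensions remains.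

Write `s = |ξ¹|² - |ξ²|²` and `r = √|det g|`. The Dirac densities become `(κ ∓ m s) r`, where the
real number `κ` (`masslessDirac`) is the sum of a derivative term, a connection term and a potential
term (`IsSpecialCase.diracLagrangian_eq`). Of the connection only the totally antisymmetric part
survives (`kinetic_connection`). Hence `L⁺ - L⁻ = -2 m s r`, which is nonzero, and `L⁺ L⁻ = (κ² - m²
s²) r²`. The theorem reduces to `‖T‖² = (16/9) ((κ/s)² - m²)`, because `ρ = s r`.

On the torsion side the rotation of `ϑ¹ + iϑ²` contributes `(4/3) m dx⁴ ∧ ϑ¹ ∧ ϑ²`, and the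
dependence on `x⁴` cancels (`contractThree_axialTorsion_eq`). The extended metric is `g - (dx⁴ -
A/m)²`, so an orthonormal coframe for it consists of `P` and `dx⁴ - A/m`; in this coframe `m dx⁴`
has components `(A, m)`. The torsion thus has one component along the indices `0, 1, 2` and three
components involving the index `4`. The first equals `(4/3) κ/s`: the torsion of the coframe
reproduces the derivative and connection terms (`wedge_coframe_identity`), and `A ∧ ϑ¹ ∧ ϑ²`
reproduces the potential term (`wedge_potential_identity`). The other three are `4m/3` times the
components of `ϑ¹ ∧ ϑ²`, whose squares sum with signs to the constant `-1`
(`coframe_minor_identity`). Here `ϑ³ = dx³` contributes nothing. The three identities are polynomial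
in the real and imaginary parts of the spinor. -/

theorem partialDeriv_congr {F : Type} [NormedAddCommGroup F] [NormedSpace ℝ F] {U : Set (ι → ℝ)}
    (hU : IsOpen U) {f h : (ι → ℝ) → F} (hfh : ∀ y ∈ U, f y = h y) {x : ι → ℝ} (hx : x ∈ U)
    (i : ι) : partialDeriv i f x = partialDeriv i h x := by
  have : f =ᶠ[𝓝 x] h := by
    filter_upwards [hU.mem_nhds hx] with y hy using hfh y hy
  simp only [partialDeriv, this.fderiv_eq]

theorem partialDeriv_const {F : Type} [NormedAddCommGroup F] [NormedSpace ℝ F] (c : F)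
    (x : ι → ℝ) (i : ι) : partialDeriv i (fun _ => c) x = 0 := by
  simp [partialDeriv]

theorem partialDeriv_mul {𝔸 : Type} [NormedCommRing 𝔸] [NormedAlgebra ℝ 𝔸] {f h : (ι → ℝ) → 𝔸}
    {x : ι → ℝ} (hf : DifferentiableAt ℝ f x) (hh : DifferentiableAt ℝ h x) (i : ι) :
    partialDeriv i (fun y => f y * h y) x
      = f x * partialDeriv i h x + partialDeriv i f x * h x := by
  simp only [partialDeriv, fderiv_fun_mul hf hh]
  simp [mul_comm]

theorem partialDeriv_add {F : Type} [NormedAddCommGroup F] [NormedSpace ℝ F] {f h : (ι → ℝ) → F}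
    {x : ι → ℝ} (hf : DifferentiableAt ℝ f x) (hh : DifferentiableAt ℝ h x) (i : ι) :
    partialDeriv i (fun y => f y + h y) x = partialDeriv i f x + partialDeriv i h x := by
  simp only [partialDeriv, fderiv_fun_add hf hh]
  rfl

theorem partialDeriv_sub {F : Type} [NormedAddCommGroup F] [NormedSpace ℝ F] {f h : (ι → ℝ) → F}
    {x : ι → ℝ} (hf : DifferentiableAt ℝ f x) (hh : DifferentiableAt ℝ h x) (i : ι) :
    partialDeriv i (fun y => f y - h y) x = partialDeriv i f x - partialDeriv i h x := by
  simp only [partialDeriv, fderiv_fun_sub hf hh]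
  rfl

theorem partialDeriv_sum {κ : Type} {F : Type} [NormedAddCommGroup F] [NormedSpace ℝ F]
    (s : Finset κ) {f : κ → (ι → ℝ) → F} {x : ι → ℝ}
    (hf : ∀ k ∈ s, DifferentiableAt ℝ (f k) x) (i : ι) :
    partialDeriv i (fun y => ∑ k ∈ s, f k y) x = ∑ k ∈ s, partialDeriv i (f k) x := by
  simp only [partialDeriv, fderiv_fun_sum hf]
  simp

theorem partialDeriv_ofReal {f : (ι → ℝ) → ℝ} {x : ι → ℝ} (hf : DifferentiableAt ℝ f x) (i : ι) :
    partialDeriv i (fun y => (f y : ℂ)) x = ((partialDeriv i f x : ℝ) : ℂ) := by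
  have h := (Complex.ofRealCLM.hasFDerivAt (x := f x)).comp x hf.hasFDerivAt
  have h2 : fderiv ℝ (fun y => (f y : ℂ)) x = Complex.ofRealCLM.comp (fderiv ℝ f x) := h.fderiv
  simp [partialDeriv, h2]

theorem partialDeriv_re {f : (ι → ℝ) → ℂ} {x : ι → ℝ} (hf : DifferentiableAt ℝ f x) (i : ι) :
    partialDeriv i (fun y => (f y).re) x = (partialDeriv i f x).re := by
  have h := (Complex.reCLM.hasFDerivAt (x := f x)).comp x hf.hasFDerivAt
  have h2 : fderiv ℝ (fun y => (f y).re) x = Complex.reCLM.comp (fderiv ℝ f x) := h.fderiv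
  simp [partialDeriv, h2]

theorem partialDeriv_im {f : (ι → ℝ) → ℂ} {x : ι → ℝ} (hf : DifferentiableAt ℝ f x) (i : ι) :
    partialDeriv i (fun y => (f y).im) x = (partialDeriv i f x).im := by
  have h := (Complex.imCLM.hasFDerivAt (x := f x)).comp x hf.hasFDerivAt
  have h2 : fderiv ℝ (fun y => (f y).im) x = Complex.imCLM.comp (fderiv ℝ f x) := h.fderiv
  simp [partialDeriv, h2]

end PartialDeriv

/-- Functions that do not depend on `x³` have vanishing derivative along `x³`. -/
theorem IndepOfX3.partialDeriv_eq_zero {F : Type} [NormedAddCommGroup F] [NormedSpace ℝ F]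
    {U : Set Point} (hU : IsOpen U) {f : Point → F} (hf : IndepOfX3 U f) {x : Point} (hx : x ∈ U)
    (hd : DifferentiableAt ℝ f x) : partialDeriv 3 f x = 0 := by
  have hline : HasDerivAt (fun t : ℝ => x + t • (Pi.single 3 1 : Point)) (Pi.single 3 1) 0 := by
    simpa using ((hasDerivAt_id (0 : ℝ)).smul_const (Pi.single 3 1 : Point)).const_add x
  have h1 : HasDerivAt (fun t : ℝ => f (x + t • (Pi.single 3 1 : Point)))
      (fderiv ℝ f x (Pi.single 3 1)) 0 := by
    have hd' : HasFDerivAt f (fderiv ℝ f x) (x + (0 : ℝ) • (Pi.single 3 1 : Point)) := by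
      simpa using hd.hasFDerivAt
    exact hd'.comp_hasDerivAt 0 hline
  -- Independence of `x³` compares only points of `U`, so the restriction to the line is known to be
  -- constant only near `t = 0`; openness of `U` provides this.
  have h2 : (fun t : ℝ => f (x + t • (Pi.single 3 1 : Point))) =ᶠ[𝓝 0] fun _ => f x := by
    have hc : Tendsto (fun t : ℝ => x + t • (Pi.single 3 1 : Point)) (𝓝 0) (𝓝 x) := by
      have := hline.continuousAt.tendsto
      simpa using this
    filter_upwards [hc.eventually (hU.mem_nhds hx)] with t ht
    refine hf _ ht _ hx fun α hα => ?_
    simp [hα]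
  exact h1.unique ((hasDerivAt_const (0 : ℝ) (f x)).congr_of_eventuallyEq h2)

/-! ### Differentiability of matrix inverses -/

theorem differentiableAt_det {ι : Type} [Fintype ι] [DecidableEq ι] {V : Type}
    [NormedAddCommGroup V] [NormedSpace ℝ V] {M : V → Matrix ι ι ℝ} {x : V}
    (hM : ∀ i j, DifferentiableAt ℝ (fun y => M y i j) x) :
    DifferentiableAt ℝ (fun y => (M y).det) x := by
  simp only [Matrix.det_apply]
  refine DifferentiableAt.fun_sum fun τ _ => DifferentiableAt.const_smul ?_ _
  exact (HasFDerivAt.finsetProd fun i _ => (hM (τ i) i).hasFDerivAt).differentiableAt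

/-- Cramer's rule: each entry of the inverse is a quotient of determinants of differentiable
matrices. -/
theorem differentiableAt_inv {ι : Type} [Fintype ι] [DecidableEq ι] {V : Type}
    [NormedAddCommGroup V] [NormedSpace ℝ V] {M : V → Matrix ι ι ℝ} {x : V}
    (hM : ∀ i j, DifferentiableAt ℝ (fun y => M y i j) x) (hdet : (M x).det ≠ 0) (i j : ι) :
    DifferentiableAt ℝ (fun y => (M y)⁻¹ i j) x := by
  simp only [Matrix.inv_def, Matrix.smul_apply, Ring.inverse_eq_inv, smul_eq_mul,
    Matrix.adjugate_apply]
  refine ((differentiableAt_det hM).inv hdet).mul (differentiableAt_det fun k l => ?_)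
  by_cases hk : k = j
  · subst hk
    simp
  · simpa [Matrix.updateRow_ne hk] using hM k l

/-! ### The frame of a field of Pauli matrices -/

/-- The signs of the Minkowski metric. -/
def signs : Fin 4 → ℝ := ![1, -1, -1, -1]

/-- The constant Pauli matrices. -/
def pauli : Fin 4 → Matrix (Fin 2) (Fin 2) ℂ :=
  ![!![1, 0; 0, 1], !![0, 1; 1, 0], !![0, Complex.I; -Complex.I, 0], !![1, 0; 0, -1]]

/-- The components of a family of Hermitian matrices in the constant Pauli matrices. -/
def frame (S : Fin 4 → Matrix (Fin 2) (Fin 2) ℂ) : Matrix (Fin 4) (Fin 4) ℝ :=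
  Matrix.of fun k α => ![((S α 0 0).re + (S α 1 1).re) / 2, (S α 0 1).re, (S α 0 1).im,
    ((S α 0 0).re - (S α 1 1).re) / 2] k

theorem eq_sum_frame_mul_pauli {S : Fin 4 → Matrix (Fin 2) (Fin 2) ℂ}
    (hS : ∀ α, (S α).IsHermitian) (α : Fin 4) (a b : Fin 2) :
    S α a b = ∑ k, (frame S k α : ℂ) * pauli k a b := by
  have h00 := (hS α).apply 0 0
  have h11 := (hS α).apply 1 1
  have h10 := (hS α).apply 1 0
  have e00 : (S α 0 0).im = 0 := by
    have := congrArg Complex.im h00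
    simp at this; linarith
  have e11 : (S α 1 1).im = 0 := by
    have := congrArg Complex.im h11
    simp at this; linarith
  fin_cases a <;> fin_cases b <;>
    simp [Fin.sum_univ_four, frame, pauli, Complex.ext_iff, e00, e11, ← h10] <;> ring

theorem raiseSpinor_eq_sum {S : Fin 4 → Matrix (Fin 2) (Fin 2) ℂ}
    (hS : ∀ α, (S α).IsHermitian) (α : Fin 4) (a b : Fin 2) :
    raiseSpinor S α a b = ∑ k, (frame S k α : ℂ) * raiseSpinor pauli k a b := by
  simp only [raiseSpinor, eq_sum_frame_mul_pauli hS α, Finset.mul_sum]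
  rw [Finset.sum_comm_cycle]
  refine Finset.sum_congr rfl fun c _ => Finset.sum_congr rfl fun d _ => ?_
  refine Finset.sum_congr rfl fun k _ => by ring

/-- The real part of the single entry `a = c = 0` of the Clifford relation already determines the
metric, because the constant Pauli matrices satisfy that relation for the Minkowski metric. -/
theorem metric_eq_frame {G : Matrix (Fin 4) (Fin 4) ℝ} {S : Fin 4 → Matrix (Fin 2) (Fin 2) ℂ}
    (hS : ∀ α, (S α).IsHermitian)
    (hcl : ∀ α β : Fin 4, ∀ a c : Fin 2,
      ∑ b, (S α a b * raiseSpinor S β c b + S β a b * raiseSpinor S α c b)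
        = if a = c then 2 * (G α β : ℂ) else 0) :
    G = (frame S).transpose * Matrix.diagonal signs * frame S := by
  ext α β
  have h := hcl α β 0 0
  rw [Matrix.mul_apply]
  simp only [Matrix.mul_diagonal, Matrix.transpose_apply]
  simp only [eq_sum_frame_mul_pauli hS, raiseSpinor_eq_sum hS] at h
  have h' := congrArg Complex.re h
  simp [Fin.sum_univ_four, Fin.sum_univ_two, pauli, raiseSpinor, eps] at h'
  simp [Fin.sum_univ_four, signs]
  linarith

theorem signs_mul_self (k : Fin 4) : signs k * signs k = 1 := by
  fin_cases k <;> simp [signs]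

theorem inv_eq_of_eq_frame {ι : Type} [Fintype ι] [DecidableEq ι] {G P E : Matrix ι ι ℝ}
    {d : ι → ℝ} (hd : ∀ i, d i * d i = 1) (hG : G = P.transpose * Matrix.diagonal d * P)
    (hP : P * E = 1) : G⁻¹ = E * Matrix.diagonal d * E.transpose := by
  refine Matrix.inv_eq_right_inv ?_
  have h2 : P.transpose * E.transpose = 1 := by
    rw [← Matrix.transpose_mul, mul_eq_one_comm.mp hP, Matrix.transpose_one]
  have h3 : Matrix.diagonal d * Matrix.diagonal d = 1 := by
    rw [Matrix.diagonal_mul_diagonal]; simp [hd]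
  calc G * (E * Matrix.diagonal d * E.transpose)
      = P.transpose * Matrix.diagonal d * (P * E) * Matrix.diagonal d * E.transpose := by
        rw [hG]; simp only [Matrix.mul_assoc]
    _ = P.transpose * (Matrix.diagonal d * Matrix.diagonal d) * E.transpose := by
        rw [hP]; simp only [Matrix.mul_assoc, Matrix.one_mul]
    _ = 1 := by rw [h3, Matrix.mul_one, h2]

/-- A frame field `P` for the metric `g` on `U`, with dual frame `P⁻¹`, such that the Pauli matrices
are the constant ones in this frame. -/
structure IsFrame (U : Set Point) (g : Point → Matrix (Fin 4) (Fin 4) ℝ)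
    (σ : Point → Fin 4 → Matrix (Fin 2) (Fin 2) ℂ) (P : Point → Matrix (Fin 4) (Fin 4) ℝ) :
    Prop where
  differentiable : ∀ k α, ∀ x ∈ U, DifferentiableAt ℝ (fun y => P y k α) x
  isUnit_det : ∀ x ∈ U, IsUnit (P x).det
  metric : ∀ x ∈ U, g x = (P x).transpose * Matrix.diagonal signs * P x
  sigma : ∀ x ∈ U, ∀ α a b, σ x α a b = ∑ k, (P x k α : ℂ) * pauli k a b
  raise : ∀ x ∈ U, ∀ α a b,
    raiseSpinor (σ x) α a b = ∑ k, (P x k α : ℂ) * raiseSpinor pauli k a b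

theorem IsPauli.isFrame {U : Set Point} (hU : IsOpen U) {g : Point → Matrix (Fin 4) (Fin 4) ℝ}
    (hg : IsLorentzMetric U g) {σ : Point → Fin 4 → Matrix (Fin 2) (Fin 2) ℂ}
    (hσ : IsPauli U g σ) : IsFrame U g σ (fun x => frame (σ x)) where
  differentiable k α x hx := by
    have h : ∀ a b, DifferentiableAt ℝ (fun y => σ y α a b) x := fun a b =>
      (hσ.differentiable α a b).differentiableAt (hU.mem_nhds hx)
    have hre : ∀ a b, DifferentiableAt ℝ (fun y => (σ y α a b).re) x := fun a b =>
      Complex.reCLM.differentiableAt.comp x (h a b)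
    have him : ∀ a b, DifferentiableAt ℝ (fun y => (σ y α a b).im) x := fun a b =>
      Complex.imCLM.differentiableAt.comp x (h a b)
    fin_cases k
    · simpa [frame, div_eq_mul_inv] using ((hre 0 0).fun_add (hre 1 1)).mul_const (2⁻¹ : ℝ)
    · simpa [frame] using hre 0 1
    · simpa [frame] using him 0 1
    · simpa [frame, div_eq_mul_inv] using ((hre 0 0).fun_sub (hre 1 1)).mul_const (2⁻¹ : ℝ)
  isUnit_det x hx := by
    have h := metric_eq_frame (hσ.hermitian x hx) (hσ.clifford x hx)
    obtain ⟨Q, hQ, hgQ⟩ := hg.signature x hx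
    -- A singular `P` would make `det g` vanish, which the Lorentzian signature excludes.
    have h1 := congrArg Matrix.det (h.symm.trans hgQ)
    simp only [Matrix.det_mul, Matrix.det_transpose, minkowski, Matrix.det_diagonal] at h1
    rw [isUnit_iff_ne_zero] at hQ ⊢
    intro h0
    rw [h0] at h1
    simp [Fin.prod_univ_four, hQ] at h1
  metric x hx := metric_eq_frame (hσ.hermitian x hx) (hσ.clifford x hx)
  sigma x hx := eq_sum_frame_mul_pauli (hσ.hermitian x hx)
  raise x hx := raiseSpinor_eq_sum (hσ.hermitian x hx)

/-- The derivatives `∂_α P^k_β` of a frame field, contracted with the dual frame. -/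
def frameDeriv (P : Point → Matrix (Fin 4) (Fin 4) ℝ) (x : Point) (k j n : Fin 4) : ℝ :=
  ∑ α, ∑ β, (P x)⁻¹ α j * (P x)⁻¹ β n * partialDeriv α (fun y => P y k β) x

/-- The components `E_j^α P^k_β ∇_α E_n^β` of the Levi-Civita connection of the metric for which a
frame field with derivatives `D` is orthonormal. -/
def connection (D : Fin 4 → Fin 4 → Fin 4 → ℝ) (k j n : Fin 4) : ℝ :=
  -D k j n + (1 / 2) * (D k j n + signs k * signs n * D n j k
    + (D k n j + signs k * signs j * D j n k)
    - (signs k * signs j * D j k n + signs k * signs n * D n k j))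

/-! ### The Levi-Civita connection in an orthonormal frame -/

namespace IsFrame

variable {U : Set Point} {g : Point → Matrix (Fin 4) (Fin 4) ℝ}
  {σ : Point → Fin 4 → Matrix (Fin 2) (Fin 2) ℂ} {P : Point → Matrix (Fin 4) (Fin 4) ℝ}
  (hF : IsFrame U g σ P) {x : Point} (hx : x ∈ U)

include hF hx

theorem mul_inv : P x * (P x)⁻¹ = 1 := Matrix.mul_nonsing_inv _ (hF.isUnit_det x hx)

theorem sum_mul_inv (k n : Fin 4) : ∑ β, P x k β * (P x)⁻¹ β n = if k = n then 1 else 0 := by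
  rw [← Matrix.mul_apply, hF.mul_inv hx, Matrix.one_apply]

theorem inv_metric : (g x)⁻¹ = (P x)⁻¹ * Matrix.diagonal signs * (P x)⁻¹.transpose :=
  inv_eq_of_eq_frame signs_mul_self (hF.metric x hx) (hF.mul_inv hx)

theorem sum_frame_mul_inv_metric (k δ : Fin 4) :
    ∑ β, P x k β * (g x)⁻¹ β δ = signs k * (P x)⁻¹ δ k := by
  have h : P x * (g x)⁻¹ = Matrix.diagonal signs * (P x)⁻¹.transpose := by
    rw [hF.inv_metric hx, ← Matrix.mul_assoc, ← Matrix.mul_assoc, hF.mul_inv hx, Matrix.one_mul]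
  rw [← Matrix.mul_apply, h, Matrix.diagonal_mul, Matrix.transpose_apply]

theorem raiseTensor_eq (α : Fin 4) (a b : Fin 2) :
    raiseTensor g σ x α a b = ∑ k, ((P x)⁻¹ α k : ℂ) * (signs k * pauli k a b) := by
  have h : ∀ k, ∑ β, (g x)⁻¹ α β * P x k β = (P x)⁻¹ α k * signs k := fun k => by
    have hm : (g x)⁻¹ * (P x).transpose = (P x)⁻¹ * Matrix.diagonal signs := by
      rw [hF.inv_metric hx, Matrix.mul_assoc, ← Matrix.transpose_mul, hF.mul_inv hx,
        Matrix.transpose_one, Matrix.mul_one]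
    have := congrFun (congrFun hm α) k
    rwa [Matrix.mul_apply, Matrix.mul_diagonal] at this
  simp only [raiseTensor, hF.sigma x hx, Finset.mul_sum]
  rw [Finset.sum_comm]
  refine Finset.sum_congr rfl fun k _ => ?_
  simp only [← mul_assoc]
  rw [← Finset.sum_mul, ← Complex.ofReal_mul, ← h k]
  push_cast
  rfl

theorem sum_frame_mul_raiseTensor (k : Fin 4) (a b : Fin 2) :
    ∑ α, (P x k α : ℂ) * raiseTensor g σ x α a b = signs k * pauli k a b := by
  simp only [hF.raiseTensor_eq hx, Finset.mul_sum]
  rw [Finset.sum_comm]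
  simp only [← mul_assoc (P x k _ : ℂ), ← Finset.sum_mul]
  have h : ∀ n, ∑ α, (P x k α : ℂ) * ((P x)⁻¹ α n : ℂ) = if k = n then 1 else 0 := fun n => by
    have := congrArg (fun r : ℝ => (r : ℂ)) (hF.sum_mul_inv hx k n)
    push_cast at this
    rw [this]
    split_ifs <;> simp
  simp [h]

theorem differentiableAt_inv (α k : Fin 4) : DifferentiableAt ℝ (fun y => (P y)⁻¹ α k) x :=
  CosseratDirac.differentiableAt_inv (fun k α => hF.differentiable k α x hx)
    (hF.isUnit_det x hx).ne_zero α k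

theorem differentiableAt_ofReal (k α : Fin 4) : DifferentiableAt ℝ (fun y => (P y k α : ℂ)) x :=
  Complex.ofRealCLM.differentiableAt.comp x (hF.differentiable k α x hx)

theorem differentiableAt_raiseTensor (hU : IsOpen U) (α : Fin 4) (a b : Fin 2) :
    DifferentiableAt ℝ (fun y => raiseTensor g σ y α a b) x := by
  have h : DifferentiableAt ℝ
      (fun y => ∑ k, ((P y)⁻¹ α k : ℂ) * (signs k * pauli k a b)) x := by
    refine DifferentiableAt.fun_sum fun k _ => DifferentiableAt.mul_const ?_ _
    exact Complex.ofRealCLM.differentiableAt.comp x (hF.differentiableAt_inv hx α k)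
  refine h.congr_of_eventuallyEq ?_
  filter_upwards [hU.mem_nhds hx] with y hy using hF.raiseTensor_eq hy α a b

/-- The frame components of `σ^α` are constant, so the product rule moves the derivative onto the
frame with a minus sign. -/
theorem sum_frame_mul_partialDeriv_raiseTensor (hU : IsOpen U) (k α : Fin 4) (a b : Fin 2) :
    ∑ β, (P x k β : ℂ) * partialDeriv α (fun y => raiseTensor g σ y β a b) x
      = -∑ β, ((partialDeriv α (fun y => P y k β) x : ℝ) : ℂ) * raiseTensor g σ x β a b := by
  have hd : ∀ β, DifferentiableAt ℝ
      (fun y => (P y k β : ℂ) * raiseTensor g σ y β a b) x := fun β =>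
    (hF.differentiableAt_ofReal hx k β).mul (hF.differentiableAt_raiseTensor hx hU β a b)
  have h := partialDeriv_congr hU (fun y hy => hF.sum_frame_mul_raiseTensor hy k a b) hx α
  rw [partialDeriv_const, partialDeriv_sum _ (fun β _ => hd β)] at h
  simp only [fun β => partialDeriv_mul (hF.differentiableAt_ofReal hx k β)
    (hF.differentiableAt_raiseTensor hx hU β a b) α,
    fun β => partialDeriv_ofReal (hF.differentiable k β x hx) α, Finset.sum_add_distrib] at h
  exact eq_neg_of_add_eq_zero_left h

theorem partialDeriv_metric (hU : IsOpen U) (α γ δ : Fin 4) :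
    partialDeriv α (fun y => g y γ δ) x
      = ∑ m, signs m * (P x m γ * partialDeriv α (fun y => P y m δ) x
          + partialDeriv α (fun y => P y m γ) x * P x m δ) := by
  have h : ∀ y ∈ U, g y γ δ = ∑ m, signs m * (P y m γ * P y m δ) := fun y hy => by
    rw [hF.metric y hy, Matrix.mul_apply]
    simp only [Matrix.mul_diagonal, Matrix.transpose_apply]
    exact Finset.sum_congr rfl fun m _ => by ring
  have hd := fun m => (hF.differentiable m γ x hx).fun_mul (hF.differentiable m δ x hx)
  rw [partialDeriv_congr hU h hx, partialDeriv_sum _ fun m _ => (hd m).const_mul _]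
  refine Finset.sum_congr rfl fun m _ => ?_
  rw [partialDeriv_mul (differentiableAt_const _) (hd m), partialDeriv_const,
    partialDeriv_mul (hF.differentiable m γ x hx) (hF.differentiable m δ x hx)]
  ring

theorem sum_partialDeriv_metric (hU : IsOpen U) (i j l : Fin 4) :
    ∑ α, ∑ γ, ∑ δ, (P x)⁻¹ α i * (P x)⁻¹ γ j * (P x)⁻¹ δ l * partialDeriv α (fun y => g y γ δ) x
      = signs j * frameDeriv P x j i l + signs l * frameDeriv P x l i j := by
  -- This treats one of the two product-rule terms of `∂g`: contracting `P` with its inverse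
  -- collapses the sum over `m`. The other term follows by exchanging `j` and `l`.
  have key : ∀ (j l : Fin 4) (w : Fin 4 → Fin 4 → ℝ),
      ∑ γ, ∑ δ, (P x)⁻¹ γ j * (P x)⁻¹ δ l * ∑ m, signs m * (P x m γ * w m δ)
        = signs j * ∑ δ, (P x)⁻¹ δ l * w j δ := fun j l w => by
    have h1 : ∀ δ, ∑ γ, (P x)⁻¹ γ j * ∑ m, signs m * (P x m γ * w m δ) = signs j * w j δ := by
      intro δ
      simp only [Finset.mul_sum]
      rw [Finset.sum_comm]
      have : ∀ m, ∑ γ, (P x)⁻¹ γ j * (signs m * (P x m γ * w m δ))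
          = signs m * w m δ * if m = j then 1 else 0 := fun m => by
        rw [← hF.sum_mul_inv hx, Finset.mul_sum]
        exact Finset.sum_congr rfl fun γ _ => by ring
      simp [this]
    rw [Finset.sum_comm, Finset.mul_sum]
    refine Finset.sum_congr rfl fun δ _ => ?_
    rw [mul_left_comm, ← h1 δ, Finset.mul_sum]
    exact Finset.sum_congr rfl fun γ _ => by ring
  have hα : ∀ α, ∑ γ, ∑ δ, (P x)⁻¹ γ j * (P x)⁻¹ δ l * partialDeriv α (fun y => g y γ δ) x
      = signs j * ∑ δ, (P x)⁻¹ δ l * partialDeriv α (fun y => P y j δ) x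
        + signs l * ∑ γ, (P x)⁻¹ γ j * partialDeriv α (fun y => P y l γ) x := fun α => by
    rw [← key j l (fun m δ => partialDeriv α (fun y => P y m δ) x),
      ← key l j (fun m γ => partialDeriv α (fun y => P y m γ) x),
      Finset.sum_comm (s := Finset.univ) (t := Finset.univ)
        (f := fun γ δ => (P x)⁻¹ γ l * (P x)⁻¹ δ j * _)]
    rw [← Finset.sum_add_distrib]
    refine Finset.sum_congr rfl fun γ _ => ?_
    rw [← Finset.sum_add_distrib]
    refine Finset.sum_congr rfl fun δ _ => ?_
    rw [hF.partialDeriv_metric hx hU, mul_comm ((P x)⁻¹ δ l), ← mul_add, ← Finset.sum_add_distrib]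
    congr 1
    exact Finset.sum_congr rfl fun m _ => by ring
  have hα' : ∀ α, ∑ γ, ∑ δ, (P x)⁻¹ α i * (P x)⁻¹ γ j * (P x)⁻¹ δ l *
        partialDeriv α (fun y => g y γ δ) x
      = (P x)⁻¹ α i * ∑ γ, ∑ δ, (P x)⁻¹ γ j * (P x)⁻¹ δ l *
        partialDeriv α (fun y => g y γ δ) x := fun α => by
    simp only [Finset.mul_sum, mul_assoc]
  simp only [hα', hα, frameDeriv, Finset.mul_sum, mul_add, Finset.sum_add_distrib]
  congr 1 <;>
  exact Finset.sum_congr rfl fun α _ => Finset.sum_congr rfl fun β _ => by ring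

theorem sum_frame_mul_christoffel (k α γ : Fin 4) :
    ∑ β, P x k β * christoffel g x β α γ
      = (1 / 2) * signs k * ∑ δ, (P x)⁻¹ δ k *
        (partialDeriv α (fun y => g y γ δ) x + partialDeriv γ (fun y => g y α δ) x
          - partialDeriv δ (fun y => g y α γ) x) := by
  simp only [christoffel, Finset.mul_sum]
  rw [Finset.sum_comm]
  refine Finset.sum_congr rfl fun δ _ => ?_
  have h := hF.sum_frame_mul_inv_metric hx k δ
  rw [mul_assoc, ← mul_assoc (signs k), ← h, Finset.sum_mul, Finset.mul_sum]
  exact Finset.sum_congr rfl fun β _ => by ring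

/-- This is Koszul's formula: the Christoffel symbols combine three index permutations of `∂g`, and
each of these is expressed through the derivatives of the frame by `sum_partialDeriv_metric`. -/
theorem connection_eq (hU : IsOpen U) (k j n : Fin 4) :
    ∑ α, (P x)⁻¹ α j * (-∑ β, partialDeriv α (fun y => P y k β) x * (P x)⁻¹ β n
        + ∑ γ, (∑ β, P x k β * christoffel g x β α γ) * (P x)⁻¹ γ n)
      = connection (frameDeriv P x) k j n := by
  have h1 := hF.sum_partialDeriv_metric hx hU j n k
  have h2 := hF.sum_partialDeriv_metric hx hU n j k
  have h3 := hF.sum_partialDeriv_metric hx hU k j n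
  have e2 : ∑ α, ∑ γ, ∑ δ, (P x)⁻¹ α n * (P x)⁻¹ γ j * (P x)⁻¹ δ k *
        partialDeriv α (fun y => g y γ δ) x
      = ∑ α, ∑ γ, ∑ δ, (P x)⁻¹ α j * (P x)⁻¹ γ n * (P x)⁻¹ δ k *
        partialDeriv γ (fun y => g y α δ) x := by
    rw [Finset.sum_comm]
    exact Finset.sum_congr rfl fun α _ => Finset.sum_congr rfl fun γ _ =>
      Finset.sum_congr rfl fun δ _ => by ring
  have e3 : ∑ α, ∑ γ, ∑ δ, (P x)⁻¹ α k * (P x)⁻¹ γ j * (P x)⁻¹ δ n *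
        partialDeriv α (fun y => g y γ δ) x
      = ∑ α, ∑ γ, ∑ δ, (P x)⁻¹ α j * (P x)⁻¹ γ n * (P x)⁻¹ δ k *
        partialDeriv δ (fun y => g y α γ) x := by
    rw [← Finset.sum_comm_cycle]
    exact Finset.sum_congr rfl fun α _ => Finset.sum_congr rfl fun γ _ =>
      Finset.sum_congr rfl fun δ _ => by ring
  rw [e2] at h2
  rw [e3] at h3
  have hmain : ∑ α, (P x)⁻¹ α j * (-∑ β, partialDeriv α (fun y => P y k β) x * (P x)⁻¹ β n
        + ∑ γ, (∑ β, P x k β * christoffel g x β α γ) * (P x)⁻¹ γ n)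
      = -frameDeriv P x k j n + (1 / 2) * signs k *
        (∑ α, ∑ γ, ∑ δ, (P x)⁻¹ α j * (P x)⁻¹ γ n * (P x)⁻¹ δ k *
          partialDeriv α (fun y => g y γ δ) x
        + ∑ α, ∑ γ, ∑ δ, (P x)⁻¹ α j * (P x)⁻¹ γ n * (P x)⁻¹ δ k *
          partialDeriv γ (fun y => g y α δ) x
        - ∑ α, ∑ γ, ∑ δ, (P x)⁻¹ α j * (P x)⁻¹ γ n * (P x)⁻¹ δ k *
          partialDeriv δ (fun y => g y α γ) x) := by
    simp only [hF.sum_frame_mul_christoffel hx, frameDeriv]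
    simp only [← Finset.sum_neg_distrib, ← Finset.sum_add_distrib, ← Finset.sum_sub_distrib,
      Finset.mul_sum, Finset.sum_mul]
    refine Finset.sum_congr rfl fun α _ => ?_
    refine Finset.sum_congr rfl fun γ _ => ?_
    rw [mul_add, Finset.mul_sum]
    congr 1
    · ring
    · exact Finset.sum_congr rfl fun δ _ => by ring
  rw [hmain, h1, h2, h3, connection]
  linear_combination (1 / 2) * (frameDeriv P x k j n + frameDeriv P x k n j) * signs_mul_self k

end IsFrame

/-! ### The spinor covariant derivative and the kinetic term in the frame -/

namespace IsFrame

variable {U : Set Point} {g : Point → Matrix (Fin 4) (Fin 4) ℝ}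
  {σ : Point → Fin 4 → Matrix (Fin 2) (Fin 2) ℂ} {P : Point → Matrix (Fin 4) (Fin 4) ℝ}
  (hF : IsFrame U g σ P) {x : Point} (hx : x ∈ U)

include hF hx

theorem sum_frame_mul_covDeriv_raiseTensor (hU : IsOpen U) (k α : Fin 4) (b c : Fin 2) :
    ∑ β, (P x k β : ℂ) * (partialDeriv α (fun y => raiseTensor g σ y β b c) x
          + ∑ γ, (christoffel g x β α γ : ℂ) * raiseTensor g σ x γ b c)
      = ∑ n, ((-∑ β, partialDeriv α (fun y => P y k β) x * (P x)⁻¹ β n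
        + ∑ γ, (∑ β, P x k β * christoffel g x β α γ) * (P x)⁻¹ γ n : ℝ) : ℂ)
        * (signs n * pauli n b c) := by
  simp only [mul_add, Finset.sum_add_distrib]
  rw [hF.sum_frame_mul_partialDeriv_raiseTensor hx hU]
  simp only [hF.raiseTensor_eq hx]
  push_cast
  simp only [add_mul, neg_mul, Finset.sum_add_distrib, Finset.sum_neg_distrib, Finset.mul_sum,
    Finset.sum_mul]
  congr 1
  · rw [Finset.sum_comm]
    simp only [mul_assoc]
  · rw [Finset.sum_comm_cycle]
    refine Finset.sum_congr rfl fun n _ => ?_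
    rw [Finset.sum_comm]
    refine Finset.sum_congr rfl fun γ _ => Finset.sum_congr rfl fun β _ => ?_
    ring

theorem sum_inv_mul_covDerivSpinor (hU : IsOpen U) (ξ : Point → Fin 2 → ℂ) (j : Fin 4)
    (a : Fin 2) :
    ∑ α, ((P x)⁻¹ α j : ℂ) * covDerivSpinor g σ ξ x α a
      = ∑ α, ((P x)⁻¹ α j : ℂ) * partialDeriv α (fun y => ξ y a) x
        + (1 / 4) * ∑ k, ∑ n, (connection (frameDeriv P x) k j n : ℂ) *
          ∑ b, ∑ c, raiseSpinor pauli k a c * (signs n * pauli n b c) * ξ x b := by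
  have h : ∀ α, ∑ β, ∑ b, ∑ c, raiseSpinor (σ x) β a c *
        (partialDeriv α (fun y => raiseTensor g σ y β b c) x
          + ∑ γ, (christoffel g x β α γ : ℂ) * raiseTensor g σ x γ b c) * ξ x b
      = ∑ k, ∑ n, ((-∑ β, partialDeriv α (fun y => P y k β) x * (P x)⁻¹ β n
        + ∑ γ, (∑ β, P x k β * christoffel g x β α γ) * (P x)⁻¹ γ n : ℝ) : ℂ) *
        ∑ b, ∑ c, raiseSpinor pauli k a c * (signs n * pauli n b c) * ξ x b := fun α => by
    have h1 : ∀ b c, ∑ β, raiseSpinor (σ x) β a c *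
        (partialDeriv α (fun y => raiseTensor g σ y β b c) x
          + ∑ γ, (christoffel g x β α γ : ℂ) * raiseTensor g σ x γ b c) * ξ x b
        = ∑ k, ∑ n, ((-∑ β, partialDeriv α (fun y => P y k β) x * (P x)⁻¹ β n
        + ∑ γ, (∑ β, P x k β * christoffel g x β α γ) * (P x)⁻¹ γ n : ℝ) : ℂ) *
        (raiseSpinor pauli k a c * (signs n * pauli n b c) * ξ x b) := fun b c => by
      simp only [hF.raise x hx, Finset.sum_mul]
      rw [Finset.sum_comm]
      refine Finset.sum_congr rfl fun k _ => ?_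
      have h2 := congrArg (fun r => raiseSpinor pauli k a c * r * ξ x b)
        (hF.sum_frame_mul_covDeriv_raiseTensor hx hU k α b c)
      simp only [Finset.mul_sum, Finset.sum_mul] at h2 ⊢
      refine Eq.trans (Finset.sum_congr rfl fun β _ => ?_)
        (h2.trans (Finset.sum_congr rfl fun n _ => ?_))
      · ring
      · ring
    rw [Finset.sum_comm]
    -- Fixing the two index types makes `Finset.sum_comm` directional: it only pulls spinor sums
    -- outside tensor sums, so `simp` cannot loop.
    simp only [Finset.sum_comm (s := Finset.univ (α := Fin 4)) (t := Finset.univ (α := Fin 2)), h1]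
    rw [Finset.sum_comm_cycle]
    simp only [Finset.sum_comm (s := Finset.univ (α := Fin 2)) (t := Finset.univ (α := Fin 4)),
      Finset.mul_sum]
  simp only [covDerivSpinor, h]
  simp only [mul_add ((P x)⁻¹ _ j : ℂ), Finset.sum_add_distrib]
  congr 1
  simp only [← hF.connection_eq hx hU, Complex.ofReal_sum, Complex.ofReal_mul]
  -- The rearrangement is stated for abstract coefficients, so that the connection and the Pauli
  -- matrices stay opaque.
  have hc : ∀ (e : Fin 4 → ℂ) (K : Fin 4 → Fin 4 → Fin 4 → ℂ) (C : Fin 4 → Fin 4 → ℂ),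
      ∑ α, e α * (1 / 4 * ∑ k, ∑ n, K k α n * C k n)
        = 1 / 4 * ∑ k, ∑ n, (∑ α, e α * K k α n) * C k n := fun e K C => by
    simp only [Finset.mul_sum, Finset.sum_mul]
    rw [Finset.sum_comm]
    refine Finset.sum_congr rfl fun k _ => ?_
    rw [Finset.sum_comm]
    exact Finset.sum_congr rfl fun n _ => Finset.sum_congr rfl fun α _ => by ring
  exact hc _ _ _

theorem sum_kinetic (ξ : Point → Fin 2 → ℂ) :
    ∑ α, ∑ a, ∑ b,
      (star (ξ x b) * raiseTensor g σ x α a b * covDerivSpinor g σ ξ x α a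
        - ξ x a * raiseTensor g σ x α a b * star (covDerivSpinor g σ ξ x α b))
    = ∑ j, ∑ a, ∑ b, signs j * pauli j a b *
      (star (ξ x b) * (∑ α, ((P x)⁻¹ α j : ℂ) * covDerivSpinor g σ ξ x α a)
        - ξ x a * star (∑ α, ((P x)⁻¹ α j : ℂ) * covDerivSpinor g σ ξ x α b)) := by
  have h : ∀ a b, ∑ α,
      (star (ξ x b) * raiseTensor g σ x α a b * covDerivSpinor g σ ξ x α a
        - ξ x a * raiseTensor g σ x α a b * star (covDerivSpinor g σ ξ x α b))
      = ∑ j, signs j * pauli j a b *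
      (star (ξ x b) * (∑ α, ((P x)⁻¹ α j : ℂ) * covDerivSpinor g σ ξ x α a)
        - ξ x a * star (∑ α, ((P x)⁻¹ α j : ℂ) * covDerivSpinor g σ ξ x α b)) := fun a b => by
    simp only [hF.raiseTensor_eq hx, star_sum, Finset.mul_sum, Finset.sum_mul,
      ← Finset.sum_sub_distrib]
    rw [Finset.sum_comm]
    refine Finset.sum_congr rfl fun j _ => Finset.sum_congr rfl fun α _ => ?_
    simp
    ring
  simp only [Finset.sum_comm (s := Finset.univ (α := Fin 4)) (t := Finset.univ (α := Fin 2)), h]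

end IsFrame

/-- The Pauli matrices are Hermitian, so the second term is the conjugate of the first. This is why
the Dirac Lagrangian is real. -/
theorem sum_pauli_mul_sub_conj (j : Fin 4) (z ω : Fin 2 → ℂ) :
    ∑ a, ∑ b, pauli j a b * (star (z b) * ω a - z a * star (ω b))
      = 2 * Complex.I * (∑ a, ∑ b, pauli j a b * star (z b) * ω a).im := by
  fin_cases j <;> simp [pauli, Fin.sum_univ_two, Complex.ext_iff] <;>
    (try constructor) <;> ring

/-- The totally antisymmetric part of the connection of an orthonormal frame in three dimensions. -/
def frameTwist (D : Fin 4 → Fin 4 → Fin 4 → ℝ) : ℝ :=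
  (D 0 1 2 - D 0 2 1) - (D 1 2 0 - D 1 0 2) - (D 2 0 1 - D 2 1 0)

/-- With nothing along the index `3`, the imaginary part of the products of three Pauli matrices
retains only the totally antisymmetric part of the connection, multiplied by the scalar `s`. -/
theorem kinetic_connection (D : Fin 4 → Fin 4 → Fin 4 → ℝ) (h1 : ∀ j n, D 3 j n = 0)
    (h2 : ∀ j n, D j 3 n = 0) (h3 : ∀ j n, D j n 3 = 0) (z : Fin 2 → ℂ) :
    ∑ j, signs j * (∑ a, ∑ b, pauli j a b * star (z b) *
      ((1 / 4) * ∑ k, ∑ n, (connection D k j n : ℂ) *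
      ∑ c, ∑ d, raiseSpinor pauli k a d * (signs n * pauli n c d) * z c)).im
    = -(1 / 4) * (‖z 0‖ ^ 2 - ‖z 1‖ ^ 2) * frameTwist D := by
  have hK1 : ∀ j n, connection D 3 j n = 0 := fun j n => by simp [connection, h1, h2, h3]
  have hK2 : ∀ j n, connection D j 3 n = 0 := fun j n => by simp [connection, h1, h2, h3]
  have hK3 : ∀ j n, connection D j n 3 = 0 := fun j n => by simp [connection, h1, h2, h3]
  simp only [Complex.sq_norm, Complex.normSq_apply]
  simp [Fin.sum_univ_four, Fin.sum_univ_two, hK1, hK2, hK3, raiseSpinor, eps, pauli, signs]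
  simp [connection, frameTwist, signs]
  ring

/-! ### Three-forms in a frame -/

theorem sum_mul_sum_diagonal {κ : Type} [Fintype κ] (T : κ → ℝ) (M : κ → κ → ℝ) (d : κ → ℝ) :
    ∑ I, ∑ L, T I * T L * ∑ A, M I A * d A * M L A = ∑ A, d A * (∑ I, T I * M I A) ^ 2 := by
  simp only [pow_two, Finset.sum_mul]
  simp only [Finset.mul_sum]
  rw [Finset.sum_comm_cycle]
  refine Finset.sum_congr rfl fun A _ => Finset.sum_congr rfl fun I _ =>
    Finset.sum_congr rfl fun L _ => by ring

/-- The components of a 3-form in a frame with dual frame `E`. -/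
def contractThree {ι : Type} [Fintype ι] (E : Matrix ι ι ℝ) (T : ι → ι → ι → ℝ) (a b c : ι) : ℝ :=
  ∑ i, ∑ j, ∑ k, T i j k * (E i a * E j b * E k c)

/-- In an orthonormal frame the norm of a 3-form is a signed sum of squares of its components. -/
theorem normSqThreeForm_eq {ι : Type} [Fintype ι] [DecidableEq ι] {G E : Matrix ι ι ℝ} {d : ι → ℝ}
    (hG : G⁻¹ = E * Matrix.diagonal d * E.transpose) (T : ι → ι → ι → ℝ) :
    normSqThreeForm G T
      = (1 / 6) * ∑ a, ∑ b, ∑ c, d a * d b * d c * contractThree E T a b c ^ 2 := by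
  have hG' : ∀ i l, G⁻¹ i l = ∑ a, E i a * d a * E l a := fun i l => by
    rw [hG, Matrix.mul_apply]
    simp [Matrix.mul_diagonal]
  -- The triple contraction is a single quadratic form on index triples, diagonalized by the tensor
  -- cube of `E`.
  have h := sum_mul_sum_diagonal (κ := ι × ι × ι) (fun I => T I.1 I.2.1 I.2.2)
    (fun I A => E I.1 A.1 * E I.2.1 A.2.1 * E I.2.2 A.2.2) (fun A => d A.1 * d A.2.1 * d A.2.2)
  simp only [Fintype.sum_prod_type] at h
  rw [normSqThreeForm]
  congr 1
  simp only [contractThree]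
  rw [← h]
  refine Finset.sum_congr rfl fun i _ => Finset.sum_congr rfl fun j _ =>
    Finset.sum_congr rfl fun k _ => Finset.sum_congr rfl fun l _ =>
    Finset.sum_congr rfl fun p _ => Finset.sum_congr rfl fun q _ => ?_
  rw [hG', hG', hG', mul_assoc, mul_assoc, ← mul_assoc (∑ a, _), Finset.sum_mul_sum,
    Finset.sum_mul]
  congr 1
  refine Finset.sum_congr rfl fun a _ => ?_
  rw [Finset.sum_mul_sum]
  exact Finset.sum_congr rfl fun b _ => Finset.sum_congr rfl fun c _ => by ring

theorem contractThree_wedge {ι : Type} [Fintype ι] (E : Matrix ι ι ℝ) (u : ι → ℝ) (F : ι → ι → ℝ)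
    (a b c : ι) :
    contractThree E (wedge u F) a b c
      = wedge (fun a => ∑ i, u i * E i a) (fun a b => ∑ i, ∑ j, F i j * (E i a * E j b)) a b c := by
  simp only [contractThree, wedge, add_mul, Finset.sum_add_distrib, Finset.sum_mul]
  simp only [Finset.mul_sum]
  refine congrArg₂ (· + ·) (congrArg₂ (· + ·) ?_ ?_) ?_
  · exact Finset.sum_congr rfl fun i _ => Finset.sum_congr rfl fun j _ =>
      Finset.sum_congr rfl fun k _ => by ring
  · rw [Finset.sum_comm]
    refine Finset.sum_congr rfl fun i _ => ?_
    rw [Finset.sum_comm]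
    exact Finset.sum_congr rfl fun j _ => Finset.sum_congr rfl fun k _ => by ring
  · rw [Finset.sum_comm_cycle]
    exact Finset.sum_congr rfl fun i _ => Finset.sum_congr rfl fun j _ =>
      Finset.sum_congr rfl fun k _ => by ring

theorem contractThree_sum {ι κ : Type} [Fintype ι] [Fintype κ] (E : Matrix ι ι ℝ) (r : ℝ)
    (w : κ → ℝ) (T : κ → ι → ι → ι → ℝ) (a b c : ι) :
    contractThree E (fun i j k => r * ∑ n, w n * T n i j k) a b c
      = r * ∑ n, w n * contractThree E (T n) a b c := by
  simp only [contractThree, Finset.mul_sum, Finset.sum_mul]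
  rw [Finset.sum_comm (γ := κ)]
  refine Finset.sum_congr rfl fun i _ => ?_
  rw [Finset.sum_comm (γ := κ)]
  refine Finset.sum_congr rfl fun j _ => ?_
  rw [Finset.sum_comm (γ := κ)]
  exact Finset.sum_congr rfl fun k _ => Finset.sum_congr rfl fun n _ => by ring

/-- The signs of the extended metric. -/
def extSigns : ExtIndex → ℝ := Sum.elim signs (fun _ => -1)

/-- Without the index `3` there remain four unordered triples from `0, 1, 2, 4`; each is counted six
times, which cancels the factor `1/6`. -/
theorem sum_sq_antisymmetric (t : ExtIndex → ExtIndex → ExtIndex → ℝ)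
    (h1 : ∀ a b c, t b a c = -t a b c) (h2 : ∀ a b c, t a c b = -t a b c)
    (h3 : ∀ b c, t (Sum.inl 3) b c = 0) :
    (1 / 6) * ∑ a, ∑ b, ∑ c, extSigns a * extSigns b * extSigns c * t a b c ^ 2
      = t (Sum.inl 0) (Sum.inl 1) (Sum.inl 2) ^ 2 + t (Sum.inl 0) (Sum.inl 1) (Sum.inr ()) ^ 2
        + t (Sum.inl 0) (Sum.inl 2) (Sum.inr ()) ^ 2
        - t (Sum.inl 1) (Sum.inl 2) (Sum.inr ()) ^ 2 := by
  have d1 : ∀ a c, t a a c = 0 := fun a c => by linarith [h1 a a c]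
  have d2 : ∀ a c, t a c c = 0 := fun a c => by linarith [h2 a c c]
  have h4 : ∀ b c, t b (Sum.inl 3) c = 0 := fun b c => by rw [h1, h3, neg_zero]
  have h5 : ∀ b c, t b c (Sum.inl 3) = 0 := fun b c => by rw [h2, h4, neg_zero]
  have e1 := fun c => h1 (Sum.inl 0) (Sum.inl 1) c
  have e2 := fun c => h1 (Sum.inl 0) (Sum.inl 2) c
  have e3 := fun c => h1 (Sum.inl 1) (Sum.inl 2) c
  have e4 := fun a c => h1 (Sum.inl a) (Sum.inr ()) c
  have f1 := fun c => h2 c (Sum.inl 0) (Sum.inl 1)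
  have f2 := fun c => h2 c (Sum.inl 0) (Sum.inl 2)
  have f3 := fun c => h2 c (Sum.inl 1) (Sum.inl 2)
  have f4 := fun a c => h2 c (Sum.inl a) (Sum.inr ())
  simp [Fintype.sum_sum_type, Fin.sum_univ_four, extSigns, signs, h3, h4, h5, d1, d2,
    e1, e2, e3, e4, f1, f2, f3, f4]
  ring

/-! ### The extended metric in a frame -/

/-- The dual frame of the extended frame consisting of `(P, 0)` and `(-A / m, 1)`. -/
def extDualFrame (m : ℝ) (E : Matrix (Fin 4) (Fin 4) ℝ) (A : Fin 4 → ℝ) :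
    Matrix ExtIndex ExtIndex ℝ :=
  Matrix.fromBlocks E 0 (Matrix.of fun _ b => (∑ α, A α * E α b) / m) 1

/-- Completing the square gives `𝐠 = g - (dx⁴ - A/m)²`, so adjoining `dx⁴ - A/m` to `P` yields an
orthonormal coframe. -/
theorem inv_extMetric {m : ℝ} (hm : m ≠ 0) {g : Point → Matrix (Fin 4) (Fin 4) ℝ}
    {A : Point → Fin 4 → ℝ} {X : ExtPoint} {P E : Matrix (Fin 4) (Fin 4) ℝ}
    (hg : g (base X) = P.transpose * Matrix.diagonal signs * P) (hP : P * E = 1) :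
    (extMetric m g A X)⁻¹ = extDualFrame m E (A (base X)) * Matrix.diagonal extSigns *
      (extDualFrame m E (A (base X))).transpose := by
  have hd : ∀ i, extSigns i * extSigns i = 1 := by
    rintro (i | i)
    · exact signs_mul_self i
    · simp [extSigns]
  refine inv_eq_of_eq_frame (P := Matrix.fromBlocks P 0 (Matrix.of fun _ β => -(A (base X) β / m)) 1)
    hd ?_ ?_
  · ext i j
    rw [Matrix.mul_apply]
    have hg' : ∀ α β, g (base X) α β = ∑ k, P k α * signs k * P k β := fun α β => by
      rw [hg, Matrix.mul_apply]
      simp [Matrix.mul_diagonal]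
    rcases i with i | i <;> rcases j with j | j <;>
      simp [extMetric, extSigns, Matrix.mul_diagonal, hg'] <;> field_simp
    ring
  · rw [extDualFrame, Matrix.fromBlocks_multiply]
    rw [← Matrix.fromBlocks_one]
    congr 1
    · simp [hP]
    · simp
    · ext i j
      simp [Matrix.mul_apply, Finset.sum_div, mul_div_right_comm]
    · simp

/-! ### Derivatives on the extended domain -/

theorem hasFDerivAt_base (X : ExtPoint) :
    HasFDerivAt base (ContinuousLinearMap.pi fun α : Fin 4 =>
      ContinuousLinearMap.proj (R := ℝ) (φ := fun _ : ExtIndex => ℝ) (Sum.inl α)) X :=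
  (ContinuousLinearMap.pi fun α : Fin 4 =>
    ContinuousLinearMap.proj (R := ℝ) (φ := fun _ : ExtIndex => ℝ) (Sum.inl α)).hasFDerivAt

section Extended

variable {f : Point → ℝ} {X : ExtPoint} (hf : DifferentiableAt ℝ f (base X))

include hf

theorem differentiableAt_comp_base : DifferentiableAt ℝ (fun Y => f (base Y)) X :=
  hf.comp X (hasFDerivAt_base X).differentiableAt

theorem partialDeriv_comp_base_inl (α : Fin 4) :
    partialDeriv (Sum.inl α) (fun Y => f (base Y)) X = partialDeriv α f (base X) := by
  have h := hf.hasFDerivAt.comp X (hasFDerivAt_base X)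
  simp only [partialDeriv]
  rw [show fderiv ℝ (fun Y => f (base Y)) X = _ from h.fderiv, ContinuousLinearMap.comp_apply]
  congr 1
  ext β
  by_cases hβ : β = α
  · subst hβ; simp
  · simp [hβ]

theorem partialDeriv_comp_base_inr (u : Unit) :
    partialDeriv (Sum.inr u) (fun Y => f (base Y)) X = 0 := by
  have h := hf.hasFDerivAt.comp X (hasFDerivAt_base X)
  simp only [partialDeriv]
  rw [show fderiv ℝ (fun Y => f (base Y)) X = _ from h.fderiv, ContinuousLinearMap.comp_apply]
  convert (fderiv ℝ f (base X)).map_zero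
  ext β
  simp

end Extended

theorem hasFDerivAt_last {φ : ℝ → ℝ} {φ' : ℝ} {X : ExtPoint}
    (h : HasDerivAt φ φ' (X (Sum.inr ()))) :
    HasFDerivAt (fun Y : ExtPoint => φ (Y (Sum.inr ())))
      (φ' • ContinuousLinearMap.proj (R := ℝ) (φ := fun _ : ExtIndex => ℝ) (Sum.inr ())) X :=
  h.comp_hasFDerivAt X
    (ContinuousLinearMap.proj (R := ℝ) (φ := fun _ : ExtIndex => ℝ) (Sum.inr ())).hasFDerivAt

theorem partialDeriv_last_inl {φ : ℝ → ℝ} {φ' : ℝ} {X : ExtPoint}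
    (h : HasDerivAt φ φ' (X (Sum.inr ()))) (α : Fin 4) :
    partialDeriv (Sum.inl α) (fun Y : ExtPoint => φ (Y (Sum.inr ()))) X = 0 := by
  simp [partialDeriv, (hasFDerivAt_last h).fderiv]

theorem partialDeriv_last_inr {φ : ℝ → ℝ} {φ' : ℝ} {X : ExtPoint}
    (h : HasDerivAt φ φ' (X (Sum.inr ()))) :
    partialDeriv (Sum.inr ()) (fun Y : ExtPoint => φ (Y (Sum.inr ()))) X = φ' := by
  simp [partialDeriv, (hasFDerivAt_last h).fderiv]

theorem extDerivCovector_antisymm {ι : Type} [Fintype ι] [DecidableEq ι] (ω : (ι → ℝ) → ι → ℝ)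
    (x : ι → ℝ) (i j : ι) : extDerivCovector ω x j i = -extDerivCovector ω x i j := by
  simp [extDerivCovector]

/-- The 2-form `F + 2m dx⁴ ∧ v` on the extended domain. -/
def extTwoForm (m : ℝ) (F : Fin 4 → Fin 4 → ℝ) (v : Fin 4 → ℝ) : ExtIndex → ExtIndex → ℝ
  | Sum.inl α, Sum.inl β => F α β
  | Sum.inl α, Sum.inr _ => -(2 * m * v α)
  | Sum.inr _, Sum.inl β => 2 * m * v β
  | Sum.inr _, Sum.inr _ => 0

theorem extDerivCovector_extendCovector (m : ℝ) {ω : Point → Fin 4 → ℝ} {X : ExtPoint}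
    (hω : ∀ β, DifferentiableAt ℝ (fun y => ω y β) (base X)) :
    extDerivCovector (extendCovector ω) X = extTwoForm m (extDerivCovector ω (base X)) 0 := by
  ext i j
  rcases i with α | u <;> rcases j with β | w
  · simp [extDerivCovector, extendCovector, extTwoForm,
      partialDeriv_comp_base_inl (hω _)]
  · simp [extDerivCovector, extendCovector, extTwoForm,
      partialDeriv_comp_base_inr (hω _), partialDeriv_const]
  · simp [extDerivCovector, extendCovector, extTwoForm,
      partialDeriv_comp_base_inr (hω _), partialDeriv_const]
  · simp [extDerivCovector, extendCovector, extTwoForm, partialDeriv_const]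

theorem extDerivCovector_rotating (m : ℝ) {p q : Point → Fin 4 → ℝ} {X : ExtPoint}
    {C S : ℝ → ℝ} (hC : HasDerivAt C (-(2 * m * S (X (Sum.inr ())))) (X (Sum.inr ())))
    (hS : HasDerivAt S (2 * m * C (X (Sum.inr ()))) (X (Sum.inr ())))
    (hp : ∀ β, DifferentiableAt ℝ (fun y => p y β) (base X))
    (hq : ∀ β, DifferentiableAt ℝ (fun y => q y β) (base X)) :
    extDerivCovector (fun Y => Sum.elim (fun β => p (base Y) β * C (Y (Sum.inr ()))
        + q (base Y) β * S (Y (Sum.inr ()))) (fun _ => 0)) X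
      = extTwoForm m (fun α β => extDerivCovector p (base X) α β * C (X (Sum.inr ()))
        + extDerivCovector q (base X) α β * S (X (Sum.inr ())))
        (fun β => q (base X) β * C (X (Sum.inr ())) - p (base X) β * S (X (Sum.inr ()))) := by
  have dC := (hasFDerivAt_last hC).differentiableAt
  have dS := (hasFDerivAt_last hS).differentiableAt
  have hpd := fun β => differentiableAt_comp_base (hp β)
  have hqd := fun β => differentiableAt_comp_base (hq β)
  have key : ∀ i β, partialDeriv i (fun Y : ExtPoint => p (base Y) β * C (Y (Sum.inr ()))
        + q (base Y) β * S (Y (Sum.inr ()))) X = _ := fun i β =>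
    (partialDeriv_add ((hpd β).fun_mul dC) ((hqd β).fun_mul dS) i).trans
      (congrArg₂ (· + ·) (partialDeriv_mul (hpd β) dC i) (partialDeriv_mul (hqd β) dS i))
  ext i j
  rcases i with α | u <;> rcases j with β | w
  · simp [extDerivCovector, extTwoForm, key, partialDeriv_comp_base_inl (hp _),
      partialDeriv_comp_base_inl (hq _), partialDeriv_last_inl hC, partialDeriv_last_inl hS]
    ring
  · simp [extDerivCovector, extTwoForm, key, partialDeriv_comp_base_inr (hp _), partialDeriv_const,
      partialDeriv_comp_base_inr (hq _), partialDeriv_last_inr hC, partialDeriv_last_inr hS]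
    ring
  · simp [extDerivCovector, extTwoForm, key, partialDeriv_comp_base_inr (hp _), partialDeriv_const,
      partialDeriv_comp_base_inr (hq _), partialDeriv_last_inr hC, partialDeriv_last_inr hS]
    ring
  · simp [extDerivCovector, extTwoForm, partialDeriv_const]

/-! ### The axial torsion in a frame -/

/-- The components of a covector in a frame with dual frame `E`. -/
def contractOne {ι : Type} [Fintype ι] (E : Matrix ι ι ℝ) (u : ι → ℝ) (a : ι) : ℝ :=
  ∑ i, u i * E i a

/-- The components of a 2-form in a frame with dual frame `E`. -/
def contractTwo {ι : Type} [Fintype ι] (E : Matrix ι ι ℝ) (F : ι → ι → ℝ) (a b : ι) : ℝ :=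
  ∑ i, ∑ j, F i j * (E i a * E j b)

theorem contractTwo_antisymm {ι : Type} [Fintype ι] (E : Matrix ι ι ℝ) {F : ι → ι → ℝ}
    (hF : ∀ i j, F j i = -F i j) (a b : ι) : contractTwo E F b a = -contractTwo E F a b := by
  simp only [contractTwo, ← Finset.sum_neg_distrib]
  rw [Finset.sum_comm]
  exact Finset.sum_congr rfl fun i _ => Finset.sum_congr rfl fun j _ => by rw [hF]; ring

theorem contractOne_extDualFrame (m : ℝ) (E : Matrix (Fin 4) (Fin 4) ℝ) (A v : Fin 4 → ℝ) :
    contractOne (extDualFrame m E A) (Sum.elim v (fun _ => 0))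
      = Sum.elim (contractOne E v) (fun _ => 0) := by
  ext i
  rcases i with a | u <;> simp [contractOne, extDualFrame]

/-- The dual vector with index `b` has the extra component `(A_b/m) ∂_4`; inserted into `2m dx⁴ ∧ v`
it produces `2 A ∧ v`. This is how the potential enters the torsion, with `m` cancelled. -/
theorem contractTwo_extDualFrame {m : ℝ} (hm : m ≠ 0) (E : Matrix (Fin 4) (Fin 4) ℝ)
    (A : Fin 4 → ℝ) (F : Fin 4 → Fin 4 → ℝ) (v : Fin 4 → ℝ) :
    contractTwo (extDualFrame m E A) (extTwoForm m F v)
      = extTwoForm m (fun a b => contractTwo E F a b + 2 * (contractOne E A a * contractOne E v b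
        - contractOne E A b * contractOne E v a)) (contractOne E v) := by
  ext i j
  rcases i with a | u <;> rcases j with b | w
  · simp only [contractTwo, extDualFrame, extTwoForm, Fintype.sum_sum_type, Finset.univ_unique,
      Finset.sum_singleton, Matrix.fromBlocks_apply₁₁, Matrix.fromBlocks_apply₂₁,
      Matrix.of_apply, Finset.sum_add_distrib]
    have e1 : ∑ x, -(2 * m * v x) * (E x a * ((∑ α, A α * E α b) / m))
        = -2 * ((∑ α, A α * E α b) * ∑ x, v x * E x a) := by
      rw [Finset.mul_sum, Finset.mul_sum]
      exact Finset.sum_congr rfl fun x _ => by field_simp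
    have e2 : ∑ x, 2 * m * v x * ((∑ α, A α * E α a) / m * E x b)
        = 2 * ((∑ α, A α * E α a) * ∑ x, v x * E x b) := by
      rw [Finset.mul_sum, Finset.mul_sum]
      exact Finset.sum_congr rfl fun x _ => by field_simp
    simp only [contractOne]
    rw [e1, e2]
    ring
  · simp [contractTwo, extDualFrame, extTwoForm, contractOne, Finset.mul_sum, mul_assoc]
  · simp [contractTwo, extDualFrame, extTwoForm, contractOne, Finset.mul_sum, mul_assoc]
  · simp [contractTwo, extDualFrame, extTwoForm]

theorem contractThree_axialTorsion (m : ℝ) (E : Matrix ExtIndex ExtIndex ℝ)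
    (ϑ : Fin 4 → Point → Fin 4 → ℝ) (X : ExtPoint) (a b c : ExtIndex) :
    contractThree E (axialTorsion m ϑ X) a b c
      = 1 / 3 * ∑ n, (![1, -1, -1, -1, -1] : Fin 5 → ℝ) n *
        wedge (contractOne E (extCoframe m ϑ n X))
          (contractTwo E (extDerivCovector (extCoframe m ϑ n) X)) a b c := by
  rw [show axialTorsion m ϑ X = fun i j k => 1 / 3 * ∑ n, (![1, -1, -1, -1, -1] : Fin 5 → ℝ) n *
    wedge (extCoframe m ϑ n X) (extDerivCovector (extCoframe m ϑ n) X) i j k from rfl,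
    contractThree_sum]
  simp only [contractThree_wedge]
  rfl

theorem wedge_antisymm_left {ι : Type} (u : ι → ℝ) {F : ι → ι → ℝ} (hF : ∀ i j, F j i = -F i j)
    (a b c : ι) : wedge u F b a c = -wedge u F a b c := by
  simp only [wedge]
  rw [hF a b, hF a c, hF b c]
  ring

theorem wedge_antisymm_right {ι : Type} (u : ι → ℝ) {F : ι → ι → ℝ} (hF : ∀ i j, F j i = -F i j)
    (a b c : ι) : wedge u F a c b = -wedge u F a b c := by
  simp only [wedge]
  rw [hF a b, hF a c, hF b c]
  ring

theorem contractThree_axialTorsion_antisymm_left (m : ℝ) (E : Matrix ExtIndex ExtIndex ℝ)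
    (ϑ : Fin 4 → Point → Fin 4 → ℝ) (X : ExtPoint) (a b c : ExtIndex) :
    contractThree E (axialTorsion m ϑ X) b a c = -contractThree E (axialTorsion m ϑ X) a b c := by
  simp only [contractThree_axialTorsion]
  rw [← mul_neg, ← Finset.sum_neg_distrib]
  congr 1
  refine Finset.sum_congr rfl fun n _ => ?_
  rw [wedge_antisymm_left _ (contractTwo_antisymm E (extDerivCovector_antisymm _ _)), mul_neg]

theorem contractThree_axialTorsion_antisymm_right (m : ℝ) (E : Matrix ExtIndex ExtIndex ℝ)
    (ϑ : Fin 4 → Point → Fin 4 → ℝ) (X : ExtPoint) (a b c : ExtIndex) :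
    contractThree E (axialTorsion m ϑ X) a c b = -contractThree E (axialTorsion m ϑ X) a b c := by
  simp only [contractThree_axialTorsion]
  rw [← mul_neg, ← Finset.sum_neg_distrib]
  congr 1
  refine Finset.sum_congr rfl fun n _ => ?_
  rw [wedge_antisymm_right _ (contractTwo_antisymm E (extDerivCovector_antisymm _ _)), mul_neg]

theorem extCoframe_one (m : ℝ) (ϑ : Fin 4 → Point → Fin 4 → ℝ) :
    extCoframe m ϑ 1 = fun Y => Sum.elim
      (fun β => ϑ 1 (base Y) β * Real.cos (2 * m * Y (Sum.inr ()))
        + ϑ 2 (base Y) β * Real.sin (2 * m * Y (Sum.inr ()))) (fun _ => 0) := by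
  ext Y i
  have h : -2 * Complex.I * (m : ℂ) * (Y (Sum.inr ()) : ℂ)
      = ((-(2 * m * Y (Sum.inr ())) : ℝ) : ℂ) * Complex.I := by push_cast; ring
  rcases i with β | u
  · simp only [extCoframe, Matrix.cons_val_one, Matrix.cons_val_zero, extendRotating,
      Sum.elim_inl, h]
    simp [Complex.exp_ofReal_mul_I_re, Complex.exp_ofReal_mul_I_im, -Complex.ofReal_mul,
      -Complex.ofReal_neg]
  · simp [extCoframe, extendRotating]

theorem extCoframe_two (m : ℝ) (ϑ : Fin 4 → Point → Fin 4 → ℝ) :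
    extCoframe m ϑ 2 = fun Y => Sum.elim
      (fun β => ϑ 1 (base Y) β * -Real.sin (2 * m * Y (Sum.inr ()))
        + ϑ 2 (base Y) β * Real.cos (2 * m * Y (Sum.inr ()))) (fun _ => 0) := by
  ext Y i
  have h : -2 * Complex.I * (m : ℂ) * (Y (Sum.inr ()) : ℂ)
      = ((-(2 * m * Y (Sum.inr ())) : ℝ) : ℂ) * Complex.I := by push_cast; ring
  rcases i with β | u
  · simp only [extCoframe, Matrix.cons_val, extendRotating, Sum.elim_inl, h]
    simp [Complex.exp_ofReal_mul_I_re, Complex.exp_ofReal_mul_I_im, -Complex.ofReal_mul,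
      -Complex.ofReal_neg]
  · simp [extCoframe, extendRotating]

theorem contractOne_comb {ι : Type} [Fintype ι] (E : Matrix ι ι ℝ) (u v : ι → ℝ) (c s : ℝ) :
    contractOne E (fun i => u i * c + v i * s)
      = fun a => contractOne E u a * c + contractOne E v a * s := by
  ext a
  simp only [contractOne, Finset.sum_mul, ← Finset.sum_add_distrib]
  exact Finset.sum_congr rfl fun i _ => by ring

theorem contractTwo_comb {ι : Type} [Fintype ι] (E : Matrix ι ι ℝ) (u v : ι → ι → ℝ) (c s : ℝ) :
    contractTwo E (fun i j => u i j * c + v i j * s)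
      = fun a b => contractTwo E u a b * c + contractTwo E v a b * s := by
  ext a b
  simp only [contractTwo, Finset.sum_mul, ← Finset.sum_add_distrib]
  exact Finset.sum_congr rfl fun i _ => Finset.sum_congr rfl fun j _ => by ring

section Torsion

variable {m : ℝ} (hm : m ≠ 0) (E : Matrix (Fin 4) (Fin 4) ℝ) (A : Fin 4 → ℝ)
  {ϑ : Fin 4 → Point → Fin 4 → ℝ} {X : ExtPoint}
  (hϑ : ∀ j β, DifferentiableAt ℝ (fun y => ϑ j y β) (base X))

include hm hϑ

theorem contractTwo_extCoframe_zero :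
    contractTwo (extDualFrame m E A) (extDerivCovector (extCoframe m ϑ 0) X)
      = extTwoForm m (contractTwo E (extDerivCovector (ϑ 0) (base X))) 0 := by
  have h := extDerivCovector_extendCovector m (hϑ 0)
  rw [show extCoframe m ϑ 0 = extendCovector (ϑ 0) from rfl, h, contractTwo_extDualFrame hm]
  have h0 : contractOne E 0 = 0 := by ext a; simp [contractOne]
  simp [h0]

theorem contractTwo_extCoframe_three :
    contractTwo (extDualFrame m E A) (extDerivCovector (extCoframe m ϑ 3) X)
      = extTwoForm m (contractTwo E (extDerivCovector (ϑ 3) (base X))) 0 := by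
  have h := extDerivCovector_extendCovector m (hϑ 3)
  rw [show extCoframe m ϑ 3 = extendCovector (ϑ 3) from rfl, h, contractTwo_extDualFrame hm]
  have h0 : contractOne E 0 = 0 := by ext a; simp [contractOne]
  simp [h0]

omit hm hϑ in
theorem extDerivCovector_extCoframe_four :
    extDerivCovector (extCoframe m ϑ 4) X = fun _ _ => 0 := by
  ext i j
  rw [show extCoframe m ϑ 4 = fun _ => Sum.elim (fun _ => 0) (fun _ => 1) from rfl]
  simp [extDerivCovector, partialDeriv_const]

theorem contractTwo_extCoframe_one :
    contractTwo (extDualFrame m E A) (extDerivCovector (extCoframe m ϑ 1) X)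
      = extTwoForm m (fun a b =>
        contractTwo E (extDerivCovector (ϑ 1) (base X)) a b * Real.cos (2 * m * X (Sum.inr ()))
        + contractTwo E (extDerivCovector (ϑ 2) (base X)) a b * Real.sin (2 * m * X (Sum.inr ()))
        + 2 * (contractOne E A a * (contractOne E (ϑ 2 (base X)) b *
              Real.cos (2 * m * X (Sum.inr ()))
            + contractOne E (ϑ 1 (base X)) b * -Real.sin (2 * m * X (Sum.inr ())))
          - contractOne E A b * (contractOne E (ϑ 2 (base X)) a *
              Real.cos (2 * m * X (Sum.inr ()))
            + contractOne E (ϑ 1 (base X)) a * -Real.sin (2 * m * X (Sum.inr ())))))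
        (fun b => contractOne E (ϑ 2 (base X)) b * Real.cos (2 * m * X (Sum.inr ()))
            + contractOne E (ϑ 1 (base X)) b * -Real.sin (2 * m * X (Sum.inr ()))) := by
  have hlin : HasDerivAt (fun t : ℝ => 2 * m * t) (2 * m) (X (Sum.inr ())) := by
    simpa using (hasDerivAt_id (X (Sum.inr ()))).const_mul (2 * m)
  have h := extDerivCovector_rotating m (X := X) (p := ϑ 1) (q := ϑ 2)
    (C := fun t => Real.cos (2 * m * t)) (S := fun t => Real.sin (2 * m * t))
    (by convert hlin.cos using 1; ring) (by convert hlin.sin using 1; ring) (hϑ 1) (hϑ 2)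
  rw [extCoframe_one, h, contractTwo_extDualFrame hm]
  simp only [sub_eq_add_neg, ← mul_neg, contractTwo_comb, contractOne_comb]

theorem contractTwo_extCoframe_two :
    contractTwo (extDualFrame m E A) (extDerivCovector (extCoframe m ϑ 2) X)
      = extTwoForm m (fun a b =>
        contractTwo E (extDerivCovector (ϑ 1) (base X)) a b * -Real.sin (2 * m * X (Sum.inr ()))
        + contractTwo E (extDerivCovector (ϑ 2) (base X)) a b * Real.cos (2 * m * X (Sum.inr ()))
        + 2 * (contractOne E A a * (contractOne E (ϑ 2 (base X)) b *
              -Real.sin (2 * m * X (Sum.inr ()))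
            + contractOne E (ϑ 1 (base X)) b * -Real.cos (2 * m * X (Sum.inr ())))
          - contractOne E A b * (contractOne E (ϑ 2 (base X)) a *
              -Real.sin (2 * m * X (Sum.inr ()))
            + contractOne E (ϑ 1 (base X)) a * -Real.cos (2 * m * X (Sum.inr ())))))
        (fun b => contractOne E (ϑ 2 (base X)) b * -Real.sin (2 * m * X (Sum.inr ()))
            + contractOne E (ϑ 1 (base X)) b * -Real.cos (2 * m * X (Sum.inr ()))) := by
  have hlin : HasDerivAt (fun t : ℝ => 2 * m * t) (2 * m) (X (Sum.inr ())) := by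
    simpa using (hasDerivAt_id (X (Sum.inr ()))).const_mul (2 * m)
  have h := extDerivCovector_rotating m (X := X) (p := ϑ 1) (q := ϑ 2)
    -- The imaginary part is the real part advanced by a quarter period, so this pair satisfies the
    -- same equations `C' = -2mS`, `S' = 2mC`.
    (C := fun t => -Real.sin (2 * m * t)) (S := fun t => Real.cos (2 * m * t))
    (hlin.sin.fun_neg.congr_deriv (by ring)) (hlin.cos.congr_deriv (by ring)) (hϑ 1) (hϑ 2)
  rw [extCoframe_two, h, contractTwo_extDualFrame hm]
  simp only [sub_eq_add_neg, ← mul_neg, contractTwo_comb, contractOne_comb]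

/-- Differentiating the phase turns `𝛝¹` into `𝛝²` and `𝛝²` into `-𝛝¹`, so both wedge products
contribute equally and add `4m dx⁴ ∧ ϑ¹ ∧ ϑ²`; the rotation itself leaves `ϑ¹ ∧ ϑ²` and the
remaining sum unchanged. The covector `(A, m)` is `m dx⁴` in the extended frame. -/
theorem contractThree_axialTorsion_eq (a b c : ExtIndex) :
    contractThree (extDualFrame m E A) (axialTorsion m ϑ X) a b c
      = 1 / 3 * (wedge (Sum.elim (contractOne E (ϑ 0 (base X))) (fun _ => 0))
            (extTwoForm m (contractTwo E (extDerivCovector (ϑ 0) (base X))) 0) a b c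
        - wedge (Sum.elim (contractOne E (ϑ 1 (base X))) (fun _ => 0))
            (extTwoForm m (contractTwo E (extDerivCovector (ϑ 1) (base X))) 0) a b c
        - wedge (Sum.elim (contractOne E (ϑ 2 (base X))) (fun _ => 0))
            (extTwoForm m (contractTwo E (extDerivCovector (ϑ 2) (base X))) 0) a b c
        - wedge (Sum.elim (contractOne E (ϑ 3 (base X))) (fun _ => 0))
            (extTwoForm m (contractTwo E (extDerivCovector (ϑ 3) (base X))) 0) a b c
        + 4 * wedge (Sum.elim (contractOne E A) (fun _ => m))
            (extTwoForm m (fun a b => contractOne E (ϑ 1 (base X)) a * contractOne E (ϑ 2 (base X)) b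
              - contractOne E (ϑ 1 (base X)) b * contractOne E (ϑ 2 (base X)) a) 0) a b c) := by
  have h0 : extCoframe m ϑ 0 X = Sum.elim (ϑ 0 (base X)) (fun _ => 0) := rfl
  have h3 : extCoframe m ϑ 3 X = Sum.elim (ϑ 3 (base X)) (fun _ => 0) := rfl
  have hz : contractTwo (extDualFrame m E A) (fun _ _ => 0) = fun _ _ => 0 := by
    ext a b; simp [contractTwo]
  rw [contractThree_axialTorsion]
  congr 1
  rw [Fin.sum_univ_five, contractTwo_extCoframe_zero hm E A hϑ, contractTwo_extCoframe_one hm E A hϑ,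
    contractTwo_extCoframe_two hm E A hϑ, contractTwo_extCoframe_three hm E A hϑ,
    extDerivCovector_extCoframe_four, hz, h0, h3, extCoframe_one, extCoframe_two]
  simp only [contractOne_extDualFrame, contractOne_comb]
  have hcs := Real.sin_sq_add_cos_sq (2 * m * X (Sum.inr ()))
  generalize Real.sin (2 * m * X (Sum.inr ())) = s at *
  generalize Real.cos (2 * m * X (Sum.inr ())) = C at *
  generalize contractOne E A = A'
  generalize contractOne E (ϑ 1 (base X)) = p
  generalize contractOne E (ϑ 2 (base X)) = q
  generalize contractTwo E (extDerivCovector (ϑ 1) (base X)) = dp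
  generalize contractTwo E (extDerivCovector (ϑ 2) (base X)) = dq
  -- Only this relation between sine and cosine is needed to eliminate `x⁴`; the remaining
  -- identities are polynomial.
  have hC : C ^ 2 = 1 - s ^ 2 := by linarith
  rcases a with a | a <;> rcases b with b | b <;> rcases c with c | c <;>
    simp [wedge, extTwoForm] <;> ring_nf <;> simp only [hC] <;> ring

end Torsion

/-! ### The coframe of a spinor in the frame of the Pauli matrices -/

/-- The scalar `|z¹|² - |z²|²` of a spinor. -/
def spinScalar (z : Fin 2 → ℂ) : ℝ :=
  (z 0).re * (z 0).re + (z 0).im * (z 0).im - ((z 1).re * (z 1).re + (z 1).im * (z 1).im)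

/-- The polarization of `spinScalar`, times two. -/
def spinScalarDeriv (z w : Fin 2 → ℂ) : ℝ :=
  2 * ((z 0).re * (w 0).re + (z 0).im * (w 0).im - ((z 1).re * (w 1).re + (z 1).im * (w 1).im))

/-- The components of `|z¹|² - |z²|²` times the coframe of a spinor, in the frame in which the Pauli
matrices are constant. -/
def coframeNum (z : Fin 2 → ℂ) : Fin 4 → Fin 4 → ℝ :=
  ![![(z 0).re * (z 0).re + (z 0).im * (z 0).im + ((z 1).re * (z 1).re + (z 1).im * (z 1).im),
      2 * ((z 0).re * (z 1).re + (z 0).im * (z 1).im),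
      2 * ((z 0).re * (z 1).im - (z 0).im * (z 1).re), 0],
    ![2 * ((z 0).re * (z 1).re - (z 0).im * (z 1).im),
      (z 0).re * (z 0).re - (z 0).im * (z 0).im + ((z 1).re * (z 1).re - (z 1).im * (z 1).im),
      2 * ((z 1).re * (z 1).im - (z 0).re * (z 0).im), 0],
    ![2 * ((z 0).re * (z 1).im + (z 0).im * (z 1).re),
      2 * ((z 0).re * (z 0).im + (z 1).re * (z 1).im),
      (z 0).re * (z 0).re - (z 0).im * (z 0).im - ((z 1).re * (z 1).re - (z 1).im * (z 1).im), 0],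
    ![0, 0, 0, spinScalar z]]

/-- The polarization of `coframeNum`, times two. -/
def coframeNumDeriv (z w : Fin 2 → ℂ) : Fin 4 → Fin 4 → ℝ :=
  ![![2 * ((z 0).re * (w 0).re + (z 0).im * (w 0).im + ((z 1).re * (w 1).re + (z 1).im * (w 1).im)),
      2 * ((z 0).re * (w 1).re + (w 0).re * (z 1).re + ((z 0).im * (w 1).im + (w 0).im * (z 1).im)),
      2 * ((z 0).re * (w 1).im + (w 0).re * (z 1).im - ((z 0).im * (w 1).re + (w 0).im * (z 1).re)),
      0],
    ![2 * ((z 0).re * (w 1).re + (w 0).re * (z 1).re - ((z 0).im * (w 1).im + (w 0).im * (z 1).im)),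
      2 * ((z 0).re * (w 0).re - (z 0).im * (w 0).im + ((z 1).re * (w 1).re - (z 1).im * (w 1).im)),
      2 * ((z 1).re * (w 1).im + (w 1).re * (z 1).im - ((z 0).re * (w 0).im + (w 0).re * (z 0).im)),
      0],
    ![2 * ((z 0).re * (w 1).im + (w 0).re * (z 1).im + ((z 0).im * (w 1).re + (w 0).im * (z 1).re)),
      2 * ((z 0).re * (w 0).im + (w 0).re * (z 0).im + ((z 1).re * (w 1).im + (w 1).re * (z 1).im)),
      2 * ((z 0).re * (w 0).re - (z 0).im * (w 0).im - ((z 1).re * (w 1).re - (z 1).im * (w 1).im)),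
      0],
    ![0, 0, 0, spinScalarDeriv z w]]

section Derivatives

variable {ξ : Point → Fin 2 → ℂ} {x : Point} (hξ : ∀ a, DifferentiableAt ℝ (fun y => ξ y a) x)

include hξ

theorem differentiableAt_re (a : Fin 2) : DifferentiableAt ℝ (fun y => (ξ y a).re) x :=
  Complex.reCLM.differentiableAt.comp x (hξ a)

theorem differentiableAt_im (a : Fin 2) : DifferentiableAt ℝ (fun y => (ξ y a).im) x :=
  Complex.imCLM.differentiableAt.comp x (hξ a)

theorem differentiableAt_spinScalar : DifferentiableAt ℝ (fun y => spinScalar (ξ y)) x := by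
  have r := differentiableAt_re hξ
  have i := differentiableAt_im hξ
  unfold spinScalar
  fun_prop

theorem differentiableAt_coframeNum (j k : Fin 4) :
    DifferentiableAt ℝ (fun y => coframeNum (ξ y) j k) x := by
  have r := differentiableAt_re hξ
  have i := differentiableAt_im hξ
  have s := differentiableAt_spinScalar hξ
  fin_cases j <;> fin_cases k <;> simp [coframeNum] <;> fun_prop

theorem partialDeriv_spinScalar (α : Fin 4) :
    partialDeriv α (fun y => spinScalar (ξ y)) x
      = spinScalarDeriv (ξ x) (fun a => partialDeriv α (fun y => ξ y a) x) := by
  have r := differentiableAt_re hξ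
  have i := differentiableAt_im hξ
  simp (disch := fun_prop) only [spinScalar, partialDeriv_add, partialDeriv_sub, partialDeriv_mul,
    partialDeriv_re (hξ _), partialDeriv_im (hξ _), spinScalarDeriv]
  ring

theorem partialDeriv_coframeNum (α j k : Fin 4) :
    partialDeriv α (fun y => coframeNum (ξ y) j k) x
      = coframeNumDeriv (ξ x) (fun a => partialDeriv α (fun y => ξ y a) x) j k := by
  have r := differentiableAt_re hξ
  have i := differentiableAt_im hξ
  have s := partialDeriv_spinScalar hξ α
  fin_cases j <;> fin_cases k <;>
    simp (disch := fun_prop) [coframeNum, coframeNumDeriv, partialDeriv_add, partialDeriv_sub,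
      partialDeriv_mul, partialDeriv_re (hξ _), partialDeriv_im (hξ _), partialDeriv_const, s] <;>
    ring

end Derivatives

/-- The polarization is real-linear in its second argument, so coordinate derivatives may be
replaced by derivatives along frame vectors. -/
theorem sum_mul_coframeNumDeriv (e : Fin 4 → ℝ) (z : Fin 2 → ℂ) (w : Fin 4 → Fin 2 → ℂ)
    (j k : Fin 4) :
    ∑ α, e α * coframeNumDeriv z (w α) j k
      = coframeNumDeriv z (fun a => ∑ α, (e α : ℂ) * w α a) j k := by
  fin_cases j <;> fin_cases k <;>
    simp [coframeNumDeriv, spinScalarDeriv, Fin.sum_univ_four] <;> ring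

theorem sum_mul_spinScalarDeriv (e : Fin 4 → ℝ) (z : Fin 2 → ℂ) (w : Fin 4 → Fin 2 → ℂ) :
    ∑ α, e α * spinScalarDeriv z (w α)
      = spinScalarDeriv z (fun a => ∑ α, (e α : ℂ) * w α a) := by
  simp [spinScalarDeriv, Fin.sum_univ_four]
  ring

/-! ### The torsion and the Dirac operator in the frame -/

/-- `|s|` times the exterior derivatives of the coframe, in the frame with derivatives `D`, up to
multiples of the coframe itself. -/
def coframeTwoForm (D : Fin 4 → Fin 4 → Fin 4 → ℝ) (z : Fin 2 → ℂ) (w : Fin 4 → Fin 2 → ℂ)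
    (j a b : Fin 4) : ℝ :=
  coframeNumDeriv z (w a) j b - coframeNumDeriv z (w b) j a
    + ∑ k, coframeNum z j k * (D k a b - D k b a)

/-- The derivative part of the kinetic term of the Dirac Lagrangian, in the frame. -/
def spinorKinetic (z : Fin 2 → ℂ) (w : Fin 4 → Fin 2 → ℂ) : ℝ :=
  ∑ j, signs j * (∑ a, ∑ b, pauli j a b * star (z b) * w j a).im

/-- This is the link between torsion and the massless Dirac operator. The matrix of the `coframeNum
z j k` with `j, k < 3` is `s` times a Lorentz matrix, so the derivatives of the background frame
enter as `s²` times its own twist; the derivatives of the spinor combine into the kinetic term. -/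
theorem wedge_coframe_identity (D : Fin 4 → Fin 4 → Fin 4 → ℝ) (h3 : ∀ a b, D 3 a b = 0)
    (z : Fin 2 → ℂ) (w : Fin 4 → Fin 2 → ℂ) (hw : w 3 = 0) :
    wedge (coframeNum z 0) (coframeTwoForm D z w 0) 0 1 2
      - wedge (coframeNum z 1) (coframeTwoForm D z w 1) 0 1 2
      - wedge (coframeNum z 2) (coframeTwoForm D z w 2) 0 1 2
      = spinScalar z * (spinScalar z * frameTwist D - 4 * spinorKinetic z w) := by
  simp [wedge, coframeTwoForm, coframeNum, coframeNumDeriv, spinorKinetic, frameTwist, spinScalar,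
    Fin.sum_univ_four, Fin.sum_univ_two, signs, pauli, h3, hw]
  ring

theorem wedge_potential_identity (A : Fin 4 → ℝ) (z : Fin 2 → ℂ) :
    wedge A (fun a b => coframeNum z 1 a * coframeNum z 2 b - coframeNum z 1 b * coframeNum z 2 a)
      0 1 2 = spinScalar z * (A 0 * coframeNum z 0 0 - A 1 * coframeNum z 0 1
        - A 2 * coframeNum z 0 2) := by
  simp [wedge, coframeNum, spinScalar]
  ring

/-- Up to the factor `s²`, the minors are the components of `ϑ¹ ∧ ϑ²`, the wedge of two orthonormal
spacelike covectors, so their signed square sum is fixed. -/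
theorem coframe_minor_identity (z : Fin 2 → ℂ) :
    (coframeNum z 1 1 * coframeNum z 2 2 - coframeNum z 1 2 * coframeNum z 2 1) ^ 2
      - (coframeNum z 1 0 * coframeNum z 2 1 - coframeNum z 1 1 * coframeNum z 2 0) ^ 2
      - (coframeNum z 1 0 * coframeNum z 2 2 - coframeNum z 1 2 * coframeNum z 2 0) ^ 2
      = spinScalar z ^ 4 := by
  simp [coframeNum, spinScalar]
  ring

/-- The derivatives of a spinor field along the vectors of a frame. -/
def spinorDeriv (E : Matrix (Fin 4) (Fin 4) ℝ) (ξ : Point → Fin 2 → ℂ) (x : Point) (j : Fin 4)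
    (a : Fin 2) : ℂ :=
  ∑ α, (E α j : ℂ) * partialDeriv α (fun y => ξ y a) x

/-- The Dirac Lagrangian without mass term, divided by `√|det g|`, in the frame of the Pauli
matrices. -/
def masslessDirac (A : Point → Fin 4 → ℝ) (σ : Point → Fin 4 → Matrix (Fin 2) (Fin 2) ℂ)
    (ξ : Point → Fin 2 → ℂ) (x : Point) : ℝ :=
  1 / 4 * spinScalar (ξ x) * frameTwist (frameDeriv (fun x => frame (σ x)) x)
    - spinorKinetic (ξ x) (spinorDeriv (frame (σ x))⁻¹ ξ x)
    + (contractOne (frame (σ x))⁻¹ (A x) 0 * coframeNum (ξ x) 0 0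
      - contractOne (frame (σ x))⁻¹ (A x) 1 * coframeNum (ξ x) 0 1
      - contractOne (frame (σ x))⁻¹ (A x) 2 * coframeNum (ξ x) 0 2)

theorem spinScalar_eq (z : Fin 2 → ℂ) : spinScalar z = ‖z 0‖ ^ 2 - ‖z 1‖ ^ 2 := by
  simp [spinScalar, Complex.sq_norm, Complex.normSq_apply]

/-! ### Reduction to 1+2 dimensions and the Dirac Lagrangian -/

namespace IsSpecialCase

variable {U : Set Point} {g : Point → Matrix (Fin 4) (Fin 4) ℝ} {A : Point → Fin 4 → ℝ}
  {σ : Point → Fin 4 → Matrix (Fin 2) (Fin 2) ℂ} {ξ : Point → Fin 2 → ℂ}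
  (hs : IsSpecialCase U g A σ ξ) (hF : IsFrame U g σ (fun x => frame (σ x))) {x : Point}
  (hx : x ∈ U)

include hs hx

theorem spinScalar_pos : 0 < spinScalar (ξ x) := by
  rw [spinScalar_eq]; exact hs.spinor_pos x hx

theorem frame_col (k : Fin 4) : frame (σ x) k 3 = if k = 3 then 1 else 0 := by
  fin_cases k <;> simp [frame, hs.pauli_three x hx]

include hF

/-- Since the last column of the frame is the unit vector, `g_{α3}` equals `-P^3_α`, and the block
form of the metric gives the row. -/
theorem frame_row (α : Fin 4) : frame (σ x) 3 α = if α = 3 then 1 else 0 := by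
  by_cases hα : α = 3
  · subst hα
    simp [hs.frame_col hx]
  · have h := (hs.metric_block x hx α hα).1
    rw [hF.metric x hx, Matrix.mul_apply] at h
    simp only [Matrix.mul_diagonal, Matrix.transpose_apply, hs.frame_col hx] at h
    simpa [signs, hα] using h

theorem inv_col (α : Fin 4) : (frame (σ x))⁻¹ α 3 = if α = 3 then 1 else 0 := by
  have h := Matrix.ext_iff.mpr (mul_eq_one_comm.mp (hF.mul_inv hx)) α 3
  rw [Matrix.mul_apply] at h
  simp only [hs.frame_col hx] at h
  simpa [Matrix.one_apply] using h

theorem frameDeriv_first (hU : IsOpen U) (j n : Fin 4) :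
    frameDeriv (fun x => frame (σ x)) x 3 j n = 0 := by
  have h : ∀ α β, partialDeriv α (fun y => frame (σ y) 3 β) x = 0 := fun α β => by
    rw [partialDeriv_congr hU (fun y hy => hs.frame_row hF hy β) hx, partialDeriv_const]
  simp [frameDeriv, h]

theorem frameDeriv_second (hU : IsOpen U) (k n : Fin 4) :
    frameDeriv (fun x => frame (σ x)) x k 3 n = 0 := by
  have h : ∀ β, partialDeriv 3 (fun y => frame (σ y) k β) x = 0 := fun β =>
    IndepOfX3.partialDeriv_eq_zero hU
      (fun y hy z hz hyz => by rw [hs.pauli_indep y hy z hz hyz]) hx (hF.differentiable k β x hx)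
  simp [frameDeriv, hs.inv_col hF hx, h]

theorem frameDeriv_third (hU : IsOpen U) (k j : Fin 4) :
    frameDeriv (fun x => frame (σ x)) x k j 3 = 0 := by
  have h : ∀ α, partialDeriv α (fun y => frame (σ y) k 3) x = 0 := fun α => by
    rw [partialDeriv_congr hU (fun y hy => hs.frame_col hy k) hx, partialDeriv_const]
  simp [frameDeriv, hs.inv_col hF hx, h]

theorem spinorDeriv_three (hU : IsOpen U) (hξ : ∀ a, DifferentiableAt ℝ (fun y => ξ y a) x) :
    spinorDeriv (frame (σ x))⁻¹ ξ x 3 = 0 := by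
  ext a
  have h : partialDeriv 3 (fun y => ξ y a) x = 0 :=
    IndepOfX3.partialDeriv_eq_zero hU
      (fun y hy z hz hyz => by rw [hs.spinor_indep y hy z hz hyz]) hx (hξ a)
  simp [spinorDeriv, hs.inv_col hF hx, apply_ite, h]

theorem potential_three_frame : contractOne (frame (σ x))⁻¹ (A x) 3 = 0 := by
  simp [contractOne, hs.inv_col hF hx, hs.potential_three x hx]

omit hF in
theorem mass_term :
    ∑ a, ∑ b, ξ x a * σ x 3 a b * star (ξ x b) = (spinScalar (ξ x) : ℂ) := by
  simp [hs.pauli_three x hx, Fin.sum_univ_two, spinScalar, Complex.ext_iff]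
  constructor <;> ring

theorem potential_term :
    ∑ α, ∑ a, ∑ b, (A x α : ℂ) * (ξ x a * raiseTensor g σ x α a b * star (ξ x b))
      = ((contractOne (frame (σ x))⁻¹ (A x) 0 * coframeNum (ξ x) 0 0
          - contractOne (frame (σ x))⁻¹ (A x) 1 * coframeNum (ξ x) 0 1
          - contractOne (frame (σ x))⁻¹ (A x) 2 * coframeNum (ξ x) 0 2 : ℝ) : ℂ) := by
  have h : ∑ α, ∑ a, ∑ b, (A x α : ℂ) * (ξ x a * raiseTensor g σ x α a b * star (ξ x b))
      = ∑ k, (contractOne (frame (σ x))⁻¹ (A x) k : ℂ) *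
        ∑ a, ∑ b, ξ x a * (signs k * pauli k a b) * star (ξ x b) := by
    simp only [hF.raiseTensor_eq hx, contractOne, Complex.ofReal_sum, Complex.ofReal_mul,
      Finset.mul_sum, Finset.sum_mul]
    simp only [Finset.sum_comm (s := Finset.univ (α := Fin 4)) (t := Finset.univ (α := Fin 2))]
    refine Finset.sum_congr rfl fun a _ => Finset.sum_congr rfl fun b _ => ?_
    rw [Finset.sum_comm]
    exact Finset.sum_congr rfl fun k _ => Finset.sum_congr rfl fun α _ => by ring
  rw [h, Fin.sum_univ_four, hs.potential_three_frame hF hx]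
  simp [signs, pauli, Fin.sum_univ_two, coframeNum, Complex.ext_iff]
  constructor <;> ring

theorem kinetic_term (hU : IsOpen U) :
    Complex.I / 2 * ∑ α, ∑ a, ∑ b,
      (star (ξ x b) * raiseTensor g σ x α a b * covDerivSpinor g σ ξ x α a
        - ξ x a * raiseTensor g σ x α a b * star (covDerivSpinor g σ ξ x α b))
      = ((1 / 4 * spinScalar (ξ x) * frameTwist (frameDeriv (fun x => frame (σ x)) x)
          - spinorKinetic (ξ x) (spinorDeriv (frame (σ x))⁻¹ ξ x) : ℝ) : ℂ) := by
  rw [hF.sum_kinetic hx]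
  have h1 : ∀ j, ∑ a, ∑ b, signs j * pauli j a b *
      (star (ξ x b) * (∑ α, ((frame (σ x))⁻¹ α j : ℂ) * covDerivSpinor g σ ξ x α a)
        - ξ x a * star (∑ α, ((frame (σ x))⁻¹ α j : ℂ) * covDerivSpinor g σ ξ x α b))
      = 2 * Complex.I * ((signs j * (∑ a, ∑ b, pauli j a b * star (ξ x b) *
        (∑ α, ((frame (σ x))⁻¹ α j : ℂ) * covDerivSpinor g σ ξ x α a)).im : ℝ) : ℂ) := fun j => by
    have := sum_pauli_mul_sub_conj j (ξ x)
      (fun a => ∑ α, ((frame (σ x))⁻¹ α j : ℂ) * covDerivSpinor g σ ξ x α a)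
    simp only [mul_assoc (signs j : ℂ), ← Finset.mul_sum]
    rw [this]
    push_cast
    ring
  simp only [h1, ← Finset.mul_sum, ← Complex.ofReal_sum]
  -- The factor `i/2` turns twice `i` times the imaginary part into minus that imaginary part.
  rw [show ∀ r : ℂ, Complex.I / 2 * (2 * Complex.I * r) = -r from fun r => by
    linear_combination r * Complex.I_mul_I, ← Complex.ofReal_neg]
  congr 1
  have h2 := kinetic_connection (frameDeriv (fun x => frame (σ x)) x)
    (hs.frameDeriv_first hF hx hU) (hs.frameDeriv_second hF hx hU)
    (hs.frameDeriv_third hF hx hU) (ξ x)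
  have h3 := fun j a => hF.sum_inv_mul_covDerivSpinor hx hU ξ j a
  simp only [h3, mul_add, Finset.sum_add_distrib, Complex.add_im]
  rw [h2, ← spinScalar_eq]
  simp only [spinorKinetic, spinorDeriv]
  ring

theorem diracLagrangian_eq (hU : IsOpen U) (μ : ℝ) :
    diracLagrangian μ g A σ ξ x
      = (((masslessDirac A σ ξ x - μ * spinScalar (ξ x)) * √|(g x).det| : ℝ) : ℂ) := by
  rw [diracLagrangian, hs.kinetic_term hF hx hU, hs.potential_term hF hx, hs.mass_term hx,
    masslessDirac]
  push_cast
  ring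

/-! ### The coframe -/

variable {ϑ : Fin 4 → Point → Fin 4 → ℝ} {ρ : Point → ℝ}
  (hϑ : IsExpressedBy U g σ ξ (etaOfXi σ ξ) ϑ ρ)

omit hF in
theorem norm_bispinorScalar :
    ‖bispinorScalar (ξ x) (etaOfXi σ ξ x)‖ = spinScalar (ξ x) := by
  have h : bispinorScalar (ξ x) (etaOfXi σ ξ x) = (spinScalar (ξ x) : ℂ) := by
    simp [bispinorScalar, etaOfXi, hs.pauli_three x hx, Fin.sum_univ_two, spinScalar,
      Complex.ext_iff]
    constructor <;> ring
  rw [h, Complex.norm_real, Real.norm_of_nonneg (hs.spinScalar_pos hx).le]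

include hϑ

/-- The defining equations are solved for `ϑ` in the Pauli frame: half the sum and half the
difference give `ϑ⁰` and `ϑ³`, and the real and imaginary parts of the rotating equation give `ϑ¹`
and `ϑ²`. Positivity of `s` removes the absolute value. -/
theorem coframe_eq (j α : Fin 4) :
    ϑ j x α = (∑ k, coframeNum (ξ x) j k * frame (σ x) k α) / spinScalar (ξ x) := by
  have hpos := (hs.spinScalar_pos hx).ne'
  have hp := congrArg Complex.re (hϑ.plus x hx α)
  have hm := congrArg Complex.re (hϑ.minus x hx α)
  have hr := congrArg Complex.re (hϑ.rotating x hx α)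
  have hi := congrArg Complex.im (hϑ.rotating x hx α)
  simp only [hs.norm_bispinorScalar hx, hF.sigma x hx, ← Complex.ofReal_inv, ← Complex.ofReal_neg,
    Complex.re_ofReal_mul, Complex.im_ofReal_mul, Complex.ofReal_re, neg_inv] at hp hm hr hi
  rw [eq_inv_mul_iff_mul_eq₀ hpos] at hp hm
  rw [eq_inv_mul_iff_mul_eq₀ (neg_ne_zero.mpr hpos)] at hr hi
  simp [raiseEta, etaOfXi, hs.pauli_three x hx, Fin.sum_univ_two, Fin.sum_univ_four, eps,
    pauli] at hp hm hr hi
  rw [eq_div_iff hpos]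
  fin_cases j <;> simp [coframeNum, Fin.sum_univ_four]
  · linear_combination (hp + hm) / 2
  · linear_combination -hr
  · linear_combination -hi
  · simp only [spinScalar] at *
    linear_combination (hp - hm) / 2

theorem differentiableAt_coframe (hU : IsOpen U)
    (hξ : ∀ a, DifferentiableAt ℝ (fun y => ξ y a) x) (j α : Fin 4) :
    DifferentiableAt ℝ (fun y => ϑ j y α) x := by
  have h : DifferentiableAt ℝ (fun y => (∑ k, coframeNum (ξ y) j k * frame (σ y) k α) *
      (spinScalar (ξ y))⁻¹) x := by
    refine DifferentiableAt.fun_mul (DifferentiableAt.fun_sum fun k _ => ?_)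
      ((differentiableAt_spinScalar hξ).fun_inv (hs.spinScalar_pos hx).ne')
    exact (differentiableAt_coframeNum hξ j k).fun_mul (hF.differentiable k α x hx)
  refine h.congr_of_eventuallyEq ?_
  filter_upwards [hU.mem_nhds hx] with y hy
  rw [hs.coframe_eq hF hy hϑ, div_eq_mul_inv]

theorem contractOne_coframe (j a : Fin 4) :
    contractOne (frame (σ x))⁻¹ (ϑ j x) a = coframeNum (ξ x) j a / spinScalar (ξ x) := by
  simp only [contractOne, hs.coframe_eq hF hx hϑ, div_mul_eq_mul_div, ← Finset.sum_div]
  congr 1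
  simp only [Finset.sum_mul]
  rw [Finset.sum_comm]
  simp only [mul_assoc, ← Finset.mul_sum, hF.sum_mul_inv hx]
  simp

theorem partialDeriv_coframe (hU : IsOpen U)
    (hξ : ∀ a, DifferentiableAt ℝ (fun y => ξ y a) x) (j α β : Fin 4) :
    partialDeriv α (fun y => ϑ j y β) x
      = (∑ k, (coframeNumDeriv (ξ x) (fun a => partialDeriv α (fun y => ξ y a) x) j k
            * frame (σ x) k β + coframeNum (ξ x) j k * partialDeriv α (fun y => frame (σ y) k β) x)
          - spinScalarDeriv (ξ x) (fun a => partialDeriv α (fun y => ξ y a) x) * ϑ j x β)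
        / spinScalar (ξ x) := by
  -- Differentiating the product `s ϑ` avoids the quotient rule and leaves the term `ds · ϑ` in a
  -- form that later cancels.
  have h : ∀ y ∈ U, spinScalar (ξ y) * ϑ j y β
      = ∑ k, coframeNum (ξ y) j k * frame (σ y) k β := fun y hy => by
    rw [hs.coframe_eq hF hy hϑ, mul_div_cancel₀ _ (hs.spinScalar_pos hy).ne']
  have h2 := partialDeriv_congr hU h hx α
  rw [partialDeriv_mul (differentiableAt_spinScalar hξ)
    (hs.differentiableAt_coframe hF hx hϑ hU hξ j β), partialDeriv_spinScalar hξ,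
    partialDeriv_sum _ fun k _ => (differentiableAt_coframeNum hξ j k).fun_mul
      (hF.differentiable k β x hx)] at h2
  simp only [fun k => partialDeriv_mul (differentiableAt_coframeNum hξ j k)
    (hF.differentiable k β x hx) α, partialDeriv_coframeNum hξ] at h2
  rw [eq_div_iff (hs.spinScalar_pos hx).ne', eq_sub_iff_add_eq, mul_comm]
  rw [h2]
  exact Finset.sum_congr rfl fun k _ => add_comm _ _

theorem contractTwo_coframe (hU : IsOpen U)
    (hξ : ∀ a, DifferentiableAt ℝ (fun y => ξ y a) x) (j a b : Fin 4) :
    contractTwo (frame (σ x))⁻¹ (extDerivCovector (ϑ j) x) a b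
      = (coframeTwoForm (frameDeriv (fun x => frame (σ x)) x) (ξ x)
            (spinorDeriv (frame (σ x))⁻¹ ξ x) j a b
          - (spinScalarDeriv (ξ x) (spinorDeriv (frame (σ x))⁻¹ ξ x a) * coframeNum (ξ x) j b
            - spinScalarDeriv (ξ x) (spinorDeriv (frame (σ x))⁻¹ ξ x b) * coframeNum (ξ x) j a)
            / spinScalar (ξ x)) / spinScalar (ξ x) := by
  have key : ∀ a b, ∑ α, ∑ β, partialDeriv α (fun y => ϑ j y β) x *
        ((frame (σ x))⁻¹ α a * (frame (σ x))⁻¹ β b)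
      = (coframeNumDeriv (ξ x) (spinorDeriv (frame (σ x))⁻¹ ξ x a) j b
          + ∑ k, coframeNum (ξ x) j k * frameDeriv (fun x => frame (σ x)) x k a b
          - spinScalarDeriv (ξ x) (spinorDeriv (frame (σ x))⁻¹ ξ x a) *
            (coframeNum (ξ x) j b / spinScalar (ξ x))) / spinScalar (ξ x) := fun a b => by
    have h1 : ∀ α, ∑ β, partialDeriv α (fun y => ϑ j y β) x * (frame (σ x))⁻¹ β b
        = (coframeNumDeriv (ξ x) (fun a => partialDeriv α (fun y => ξ y a) x) j b
          + ∑ k, coframeNum (ξ x) j k *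
            ∑ β, (frame (σ x))⁻¹ β b * partialDeriv α (fun y => frame (σ y) k β) x
          - spinScalarDeriv (ξ x) (fun a => partialDeriv α (fun y => ξ y a) x) *
            (coframeNum (ξ x) j b / spinScalar (ξ x))) / spinScalar (ξ x) := fun α => by
      rw [← hs.contractOne_coframe hF hx hϑ]
      simp only [hs.partialDeriv_coframe hF hx hϑ hU hξ, div_mul_eq_mul_div, ← Finset.sum_div]
      congr 1
      simp only [sub_mul, Finset.sum_sub_distrib, Finset.sum_add_distrib, add_mul, contractOne,
        Finset.mul_sum, mul_assoc]
      congr 1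
      congr 1
      · simp only [Finset.sum_mul, mul_assoc]
        rw [Finset.sum_comm]
        simp only [← Finset.mul_sum, hF.sum_mul_inv hx]
        simp
      · simp only [Finset.sum_mul]
        rw [Finset.sum_comm]
        exact Finset.sum_congr rfl fun k _ => Finset.sum_congr rfl fun β _ => by ring
    have h2 : ∑ α, ∑ β, partialDeriv α (fun y => ϑ j y β) x *
        ((frame (σ x))⁻¹ α a * (frame (σ x))⁻¹ β b)
        = ∑ α, (frame (σ x))⁻¹ α a *
          ∑ β, partialDeriv α (fun y => ϑ j y β) x * (frame (σ x))⁻¹ β b := by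
      simp only [Finset.mul_sum]
      exact Finset.sum_congr rfl fun α _ => Finset.sum_congr rfl fun β _ => by ring
    rw [h2]
    have hN : coframeNumDeriv (ξ x) (spinorDeriv (frame (σ x))⁻¹ ξ x a) j b = _ :=
      (sum_mul_coframeNumDeriv (fun α => (frame (σ x))⁻¹ α a) (ξ x)
        (fun α c => partialDeriv α (fun y => ξ y c) x) j b).symm
    have hS : spinScalarDeriv (ξ x) (spinorDeriv (frame (σ x))⁻¹ ξ x a) = _ :=
      (sum_mul_spinScalarDeriv (fun α => (frame (σ x))⁻¹ α a) (ξ x)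
        (fun α c => partialDeriv α (fun y => ξ y c) x)).symm
    simp only [h1, hN, hS, frameDeriv, mul_div_assoc', ← Finset.sum_div, mul_sub, mul_add,
      Finset.sum_sub_distrib, Finset.sum_add_distrib]
    congr 1
    congr 1
    · congr 1
      simp only [Finset.mul_sum]
      rw [Finset.sum_comm]
      exact Finset.sum_congr rfl fun k _ => Finset.sum_congr rfl fun α _ =>
        Finset.sum_congr rfl fun β _ => by ring
    · rw [Finset.sum_mul]
      simp only [mul_assoc]
  have hab : contractTwo (frame (σ x))⁻¹ (extDerivCovector (ϑ j) x) a b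
      = ∑ α, ∑ β, partialDeriv α (fun y => ϑ j y β) x *
        ((frame (σ x))⁻¹ α a * (frame (σ x))⁻¹ β b)
        - ∑ α, ∑ β, partialDeriv α (fun y => ϑ j y β) x *
        ((frame (σ x))⁻¹ α b * (frame (σ x))⁻¹ β a) := by
    simp only [contractTwo, extDerivCovector, sub_mul, Finset.sum_sub_distrib]
    congr 1
    rw [Finset.sum_comm]
    exact Finset.sum_congr rfl fun α _ => Finset.sum_congr rfl fun β _ => by ring
  rw [hab, key, key, coframeTwoForm]
  simp only [mul_sub, Finset.sum_sub_distrib]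
  ring

end IsSpecialCase

/-- The term from differentiating `1/s` is a multiple of `ω ∧ N`, and `N ∧ ω ∧ N = 0`; the
normalization therefore does not affect the torsion beyond an overall factor. -/
theorem wedge_div (N ω : Fin 4 → ℝ) (G : Fin 4 → Fin 4 → ℝ) {s : ℝ} (hs : s ≠ 0) (a b c : Fin 4) :
    wedge (fun a => N a / s) (fun a b => (G a b - (ω a * N b - ω b * N a) / s) / s) a b c
      = wedge N G a b c / s ^ 2 := by
  simp only [wedge]
  field_simp
  ring

theorem wedge_inl (u : Fin 4 → ℝ) (r : ℝ) (m : ℝ) (F : Fin 4 → Fin 4 → ℝ) (a b c : Fin 4) :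
    wedge (Sum.elim u (fun _ => r)) (extTwoForm m F 0) (Sum.inl a) (Sum.inl b) (Sum.inl c)
      = wedge u F a b c := rfl

theorem wedge_inr (u : Fin 4 → ℝ) (r : ℝ) (m : ℝ) (F : Fin 4 → Fin 4 → ℝ) (a b : Fin 4) :
    wedge (Sum.elim u (fun _ => r)) (extTwoForm m F 0) (Sum.inl a) (Sum.inl b) (Sum.inr ())
      = r * F a b := by
  simp [wedge, extTwoForm]

/-! ### The norm of the axial torsion -/

namespace IsSpecialCase

variable {U : Set Point} {g : Point → Matrix (Fin 4) (Fin 4) ℝ} {A : Point → Fin 4 → ℝ}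
  {σ : Point → Fin 4 → Matrix (Fin 2) (Fin 2) ℂ} {ξ : Point → Fin 2 → ℂ}
  (hs : IsSpecialCase U g A σ ξ) (hF : IsFrame U g σ (fun x => frame (σ x))) {x : Point}
  (hx : x ∈ U) {ϑ : Fin 4 → Point → Fin 4 → ℝ} {ρ : Point → ℝ}
  (hϑ : IsExpressedBy U g σ ξ (etaOfXi σ ξ) ϑ ρ) (hU : IsOpen U)

include hs hF hx hϑ hU

/-- Here `ϑ³ = dx³` is closed: the derivative of its numerator `s` cancels against that of the
denominator. -/
theorem contractTwo_coframe_three (hξ : ∀ a, DifferentiableAt ℝ (fun y => ξ y a) x)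
    (a b : Fin 4) : contractTwo (frame (σ x))⁻¹ (extDerivCovector (ϑ 3) x) a b = 0 := by
  have hpos := (hs.spinScalar_pos hx).ne'
  rw [hs.contractTwo_coframe hF hx hϑ hU hξ]
  have h : ∀ w c, coframeNumDeriv (ξ x) w 3 c
      = spinScalarDeriv (ξ x) w * coframeNum (ξ x) 3 c / spinScalar (ξ x) := fun w c => by
    fin_cases c <;> simp [coframeNumDeriv, coframeNum, hpos]
  have h' : ∑ k, coframeNum (ξ x) 3 k * (frameDeriv (fun x => frame (σ x)) x k a b
      - frameDeriv (fun x => frame (σ x)) x k b a) = 0 := by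
    simp [Fin.sum_univ_four, coframeNum, hs.frameDeriv_first hF hx hU]
  rw [coframeTwoForm, h, h, h']
  ring

theorem contractTwo_coframe_apply_three (hξ : ∀ a, DifferentiableAt ℝ (fun y => ξ y a) x)
    {j : Fin 4} (hj : j ≠ 3) (b : Fin 4) :
    contractTwo (frame (σ x))⁻¹ (extDerivCovector (ϑ j) x) 3 b = 0 := by
  have h : ∀ w, coframeNumDeriv (ξ x) w j 3 = 0 := fun w => by
    fin_cases j <;> simp [coframeNumDeriv] at hj ⊢
  have h0 : coframeNumDeriv (ξ x) 0 j b = 0 := by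
    fin_cases j <;> fin_cases b <;> simp [coframeNumDeriv, spinScalarDeriv]
  have h1 : coframeNum (ξ x) j 3 = 0 := by
    fin_cases j <;> simp [coframeNum] at hj ⊢
  rw [hs.contractTwo_coframe hF hx hϑ hU hξ, coframeTwoForm, hs.spinorDeriv_three hF hx hU hξ, h, h0,
    h1]
  simp [hs.frameDeriv_second hF hx hU, hs.frameDeriv_third hF hx hU, spinScalarDeriv]

theorem lagrangian_eq {m : ℝ} (hm : m ≠ 0) {X : ExtPoint} (hX : base X = x)
    (hξ : ∀ a, DifferentiableAt ℝ (fun y => ξ y a) x) :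
    lagrangian m g A ϑ ρ X
      = 16 / 9 * ((masslessDirac A σ ξ x / spinScalar (ξ x)) ^ 2 - m ^ 2)
        * (spinScalar (ξ x) * √|(g x).det|) := by
  subst hX
  have hpos := (hs.spinScalar_pos hx).ne'
  have hd := fun j β => hs.differentiableAt_coframe hF hx hϑ hU hξ j β
  have hc1 := fun j => funext (hs.contractOne_coframe hF hx hϑ j)
  have hc2 := fun j => funext fun a => funext fun b =>
    hs.contractTwo_coframe hF hx hϑ hU hξ j a b
  have hc3 : contractTwo (frame (σ (base X)))⁻¹ (extDerivCovector (ϑ 3) (base X))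
      = fun _ _ => 0 := funext fun a => funext fun b =>
    hs.contractTwo_coframe_three hF hx hϑ hU hξ a b
  have ht := contractThree_axialTorsion_eq hm (frame (σ (base X)))⁻¹ (A (base X)) hd
  have hanti := contractThree_axialTorsion_antisymm_left m
    (extDualFrame m (frame (σ (base X)))⁻¹ (A (base X))) ϑ X
  have hanti' := contractThree_axialTorsion_antisymm_right m
    (extDualFrame m (frame (σ (base X)))⁻¹ (A (base X))) ϑ X
  have hN3 : ∀ j, j ≠ 3 → coframeNum (ξ (base X)) j 3 = 0 := fun j hj => by
    fin_cases j <;> simp [coframeNum] at hj ⊢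
  have hF3 : ∀ j, j ≠ 3 → ∀ b,
      contractTwo (frame (σ (base X)))⁻¹ (extDerivCovector (ϑ j) (base X)) 3 b = 0 :=
    fun j hj b => hs.contractTwo_coframe_apply_three hF hx hϑ hU hξ hj b
  have hF3' : ∀ j, j ≠ 3 → ∀ b,
      contractTwo (frame (σ (base X)))⁻¹ (extDerivCovector (ϑ j) (base X)) b 3 = 0 :=
    fun j hj b => by
      rw [contractTwo_antisymm _ (extDerivCovector_antisymm _ _), hF3 j hj, neg_zero]
  have h34 : ∀ b, contractThree (extDualFrame m (frame (σ (base X)))⁻¹ (A (base X)))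
      (axialTorsion m ϑ X) (Sum.inl 3) (Sum.inl b) (Sum.inr ()) = 0 := fun b => by
    rw [ht]
    simp only [wedge_inr, hc1, hN3 1 (by decide), hN3 2 (by decide)]
    ring
  have h3 : ∀ b c, contractThree (extDualFrame m (frame (σ (base X)))⁻¹ (A (base X)))
      (axialTorsion m ϑ X) (Sum.inl 3) b c = 0 := by
    rintro (b | b) (c | c)
    · rw [ht]
      simp only [wedge_inl]
      rw [hc3]
      simp only [wedge, hc1, hF3 0 (by decide), hF3 1 (by decide), hF3 2 (by decide),
        hF3' 0 (by decide), hF3' 1 (by decide), hF3' 2 (by decide), hN3 0 (by decide),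
        hN3 1 (by decide), hN3 2 (by decide), hs.potential_three_frame hF hx]
      ring
    · exact h34 b
    · rw [hanti', h34, neg_zero]
    · linarith [hanti' (Sum.inl 3) (Sum.inr b) (Sum.inr c)]
  have h012 : contractThree (extDualFrame m (frame (σ (base X)))⁻¹ (A (base X)))
      (axialTorsion m ϑ X) (Sum.inl 0) (Sum.inl 1) (Sum.inl 2)
      = 4 / 3 * (masslessDirac A σ ξ (base X) / spinScalar (ξ (base X))) := by
    have e1 := wedge_coframe_identity (frameDeriv (fun x => frame (σ x)) (base X))
      (hs.frameDeriv_first hF hx hU) (ξ (base X)) (spinorDeriv (frame (σ (base X)))⁻¹ ξ (base X))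
      (hs.spinorDeriv_three hF hx hU hξ)
    have e2 := wedge_potential_identity (contractOne (frame (σ (base X)))⁻¹ (A (base X)))
      (ξ (base X))
    have e3 : ∀ (a : Fin 4 → ℝ) (p q : Fin 4 → ℝ) (s : ℝ),
        wedge a (fun a b => p a / s * (q b / s) - p b / s * (q a / s)) 0 1 2
        = wedge a (fun a b => p a * q b - p b * q a) 0 1 2 / s ^ 2 := fun a p q s => by
      simp only [wedge]
      ring
    have e4 : ∀ u : Fin 4 → ℝ, wedge u (fun _ _ => 0) 0 1 2 = 0 := fun u => by simp [wedge]
    rw [ht]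
    simp only [wedge_inl]
    rw [hc3, hc2, hc2, hc2]
    simp only [hc1]
    rw [wedge_div _ _ _ hpos, wedge_div _ _ _ hpos, wedge_div _ _ _ hpos, e3, e4, e2, sub_zero,
      ← sub_div, ← sub_div, e1, masslessDirac]
    field_simp
  have hab4 : ∀ a b, contractThree (extDualFrame m (frame (σ (base X)))⁻¹ (A (base X)))
      (axialTorsion m ϑ X) (Sum.inl a) (Sum.inl b) (Sum.inr ())
      = 4 * m / 3 * ((coframeNum (ξ (base X)) 1 a * coframeNum (ξ (base X)) 2 b
        - coframeNum (ξ (base X)) 1 b * coframeNum (ξ (base X)) 2 a)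
        / spinScalar (ξ (base X)) ^ 2) := fun a b => by
    rw [ht]
    simp only [wedge_inr, hc1]
    ring
  have hminor := coframe_minor_identity (ξ (base X))
  rw [lagrangian, normSqThreeForm_eq (inv_extMetric hm (hF.metric _ hx) (hF.mul_inv hx)),
    sum_sq_antisymmetric _ hanti hanti' h3, h012, hab4, hab4, hab4, hϑ.density _ hx,
    hs.norm_bispinorScalar hx]
  congr 1
  -- After normalization the three components with index `4` contribute exactly `-(4m/3)²`,
  -- independently of the spinor.
  have hdiv := congrArg (fun r => r / spinScalar (ξ (base X)) ^ 4) hminor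
  simp only [div_self (pow_ne_zero 4 hpos)] at hdiv
  linear_combination (-(16 / 9) * m ^ 2) * hdiv

end IsSpecialCase

end

end CosseratDirac

/-! ### Conclusion: comparison of the two Lagrangians -/

theorem mainTheorem2 (m : ℝ) (hm : 0 < m)
    (U : Set CosseratDirac.Point) (hU : IsOpen U)
    (g : CosseratDirac.Point → Matrix (Fin 4) (Fin 4) ℝ)
    (hg : CosseratDirac.IsLorentzMetric U g)
    (A : CosseratDirac.Point → Fin 4 → ℝ)
    (σ : CosseratDirac.Point → Fin 4 → Matrix (Fin 2) (Fin 2) ℂ)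
    (hσ : CosseratDirac.IsPauli U g σ)
    (ξ : CosseratDirac.Point → Fin 2 → ℂ)
    (hξ : ∀ a, DifferentiableOn ℝ (fun x => ξ x a) U)
    (hspecial : CosseratDirac.IsSpecialCase U g A σ ξ)
    (ϑ : Fin 4 → CosseratDirac.Point → Fin 4 → ℝ) (ρ : CosseratDirac.Point → ℝ)
    (hϑρ : CosseratDirac.IsExpressedBy U g σ ξ (CosseratDirac.etaOfXi σ ξ) ϑ ρ)
    (X : CosseratDirac.ExtPoint) (hX : CosseratDirac.base X ∈ U) :
    CosseratDirac.diracPlus m g A σ ξ (CosseratDirac.base X)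
        ≠ CosseratDirac.diracMinus m g A σ ξ (CosseratDirac.base X) ∧
      (CosseratDirac.lagrangian m g A ϑ ρ X : ℂ)
        = -(32 * (m : ℂ) / 9) *
          (CosseratDirac.diracPlus m g A σ ξ (CosseratDirac.base X)
              * CosseratDirac.diracMinus m g A σ ξ (CosseratDirac.base X)
            / (CosseratDirac.diracPlus m g A σ ξ (CosseratDirac.base X)
              - CosseratDirac.diracMinus m g A σ ξ (CosseratDirac.base X))) := by
  have hF := hσ.isFrame hU hg
  have hξ' := fun a => (hξ a).differentiableAt (hU.mem_nhds hX)
  have hs := hspecial.spinScalar_pos hX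
  have hdet : 0 < √|(g (CosseratDirac.base X)).det| := by
    refine Real.sqrt_pos.mpr (abs_pos.mpr ?_)
    obtain ⟨Q, hQ, hgQ⟩ := hg.signature _ hX
    rw [hgQ]
    simpa [CosseratDirac.minkowski, Fin.prod_univ_four] using hQ.ne_zero
  rw [hspecial.lagrangian_eq hF hX hϑρ hU hm.ne' rfl hξ', CosseratDirac.diracPlus,
    CosseratDirac.diracMinus, hspecial.diracLagrangian_eq hF hX hU,
    hspecial.diracLagrangian_eq hF hX hU]
  generalize CosseratDirac.masslessDirac A σ ξ (CosseratDirac.base X) = κ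
  generalize CosseratDirac.spinScalar _ = s at *
  generalize √|(g (CosseratDirac.base X)).det| = r at *
  -- The two densities differ only in the mass term, so the difference is `-2 m s r`, a product of
  -- nonzero factors.
  have hne : (κ - m * s) * r - (κ - -m * s) * r ≠ 0 := by
    rw [show (κ - m * s) * r - (κ - -m * s) * r = -(2 * m * s * r) by ring]
    exact neg_ne_zero.mpr (by positivity)
  refine ⟨fun h => hne (sub_eq_zero.mpr (Complex.ofReal_injective h)), ?_⟩
  have hreal : 16 / 9 * ((κ / s) ^ 2 - m ^ 2) * (s * r)
      = -(32 * m / 9) * ((κ - m * s) * r * ((κ - -m * s) * r)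
        / ((κ - m * s) * r - (κ - -m * s) * r)) := by
    rw [show (κ - m * s) * r - (κ - -m * s) * r = -(2 * m * s * r) by ring]
    field_simp
    ring
  rw [hreal]
  push_cast
  rfl
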